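/- **Local Dealternation Lemma.** *Definitions.* Let $\mathbb F$ be a finite field. A subspace arrangement is a finite (indexed) family $\mathcal V=\{V_1,\dots,V_n\}$ of linear subspaces of $\mathbb F^d$; for a subfamily $\mathcal A$ write $\langle\mathcal A\rangle$ for the sum of its members. A *binary tree* is a finite rooted tree in which each node has $0$ or $2$ children and which has at least two leaves. A *rooted rank decomposition* $\mathcal T=(T,\lambda)$ of $\mathcal V$ is a binary tree $T$ with a bijection $\lambda$ from $\mathcal V$ to the leaves of $T$. For a node $v$ of $T$, $\mathcal L(\mathcal T)[v]\subseteq\mathcal V$ is the set of members mapped to leaves that are descendants of $v$ (every node is a descendant of itself). The width of $\mathcal T$ is the maximum over the non-root nodes $v$ of $\dim\big(\langle\mathcal L(\mathcal T)[v]\rangle\cap\langle\mathcal V\setminus\mathcal L(\mathcal T)[v]\rangle\big)$; $\mathcal T$ has optimum width if no rooted rank decomposition of $\mathcal V$ has smaller width. A *tree factor* of $\mathcal T$ is a set $\mathcal L(\mathcal T)[v]$; a *context factor* is a difference of two tree factors that is not a tree factor; a *factor* is a tree factor or a context factor. Let $\mathcal T^b=(T^b,\lambda^b)$ and $\mathcal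 T=(T,\lambda)$ be rooted rank decompositions of $\mathcal V$, let $x\in V(T^b)$ and $\mathcal V_x=\mathcal L(\mathcal T^b)[x]$. An *$x$-factor* of $\mathcal T$ is a factor of $\mathcal T$ that is contained in $\mathcal V_x$. A node $v$ of $T$ is *$x$-full* if $\mathcal L(\mathcal T)[v]\subseteq\mathcal V_x$, *$x$-empty* if $\mathcal L(\mathcal T)[v]\cap\mathcal V_x=\emptyset$, and *$x$-mixed* otherwise. The *$x$-mixed skeleton* of $\mathcal T$ is the (possibly empty) rooted tree whose vertices are the nodes $v$ of $T$ with two children such that either one child is $x$-empty and the other $x$-full, or both children are $x$-mixed; two distinct vertices are adjacent if the path between them in $T$ has no internal node that is a vertex of the skeleton; its root is the vertex that is an ancestor in $T$ of all of its vertices. *Statement.* For every function $g\colon\mathbb N\to\mathbb N$ there is a function $f\colon\mathbb N\to\mathbb N$ such that the following holds. Let $\mathcal V$ be a subspace arrangement over $\mathbb F$, let $\mathcal T^b$ be a rooted rank decomposition of $\mathcal V$ of width $\ell\ge 0$, and let $\mathcal T$ be a rooted rank decomposition of $\mathcal V$ of optimum width. Let $x\in V(T^b)$ be such that the $x$-mixed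 skeleton of $\mathcal T$ has at most $g(\ell)$ nodes. Then there is a rooted rank decomposition $\mathcal T'$ of $\mathcal V$ of optimum width, on the same set of nodes as $\mathcal T$, such that 1. $\mathcal L(\mathcal T^b)[x]$ is a disjoint union of at most $f(\ell)$ $x$-factors of $\mathcal T'$; 2. for every $y\in V(T^b)$, the $y$-mixed skeletons of $\mathcal T$ and $\mathcal T'$ are equal; 3. for every $y\in V(T^b)$ that is not a strict ancestor of $x$, every $y$-factor of $\mathcal T$ is also a $y$-factor of $\mathcal T'$. -/

import Mathlib

/-- A rooted tree on the node set `N`, given by its root and its parent map. The root is its own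
parent by convention, and every node reaches the root by iterating `parent`. -/
structure RootedTreeOn (N : Type*) where
  root : N
  parent : N → N
  parent_root : parent root = root
  reaches_root : ∀ v, ∃ k : ℕ, parent^[k] v = root

namespace RootedTreeOn

variable {N : Type*} (T : RootedTreeOn N)

/-- The set of children of `v`. -/
def children (v : N) : Set N := {c | c ≠ T.root ∧ T.parent c = v}

/-- A leaf is a node without children. -/
def IsLeaf (v : N) : Prop := T.children v = ∅

/-- `T.Le u v`, i.e. `u ≤ v`: `u` is a (not necessarily strict) descendant of `v`. -/
def Le (u v : N) : Prop := ∃ k : ℕ, T.parent^[k] u = v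

/-- `T.Lt u v`, i.e. `u < v`: `u` is a strict descendant of `v`. -/
def Lt (u v : N) : Prop := T.Le u v ∧ u ≠ v

/-- The underlying undirected tree: the edges join the non-root nodes to their parents. -/
def graph : SimpleGraph N := SimpleGraph.fromRel fun u v => T.parent u = v

end RootedTreeOn

/-- A binary tree: a rooted tree in which every node has `0` or `2` children and which has at
least two leaves. (It is used for finite node sets `N` only.) -/
structure BinaryTreeOn (N : Type*) extends RootedTreeOn N where
  leaf_or_two_children : ∀ v, toRootedTreeOn.IsLeaf v ∨ (toRootedTreeOn.children v).ncard = 2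
  two_leaves : {v | toRootedTreeOn.IsLeaf v}.Nontrivial

/-- A rooted rank decomposition, with node set `N`, of the subspace arrangement `V`: a binary tree
with a bijection from the members of the (indexed) family `V` to the leaves. -/
structure RootedRankDecomposition {F : Type*} [Field F] {d : ℕ} {ι : Type*}
    (V : ι → Submodule F (Fin d → F)) (N : Type*) where
  tree : BinaryTreeOn N
  leaf : ι ≃ {v : N // tree.IsLeaf v}

/-- The data of a (possibly empty) rooted tree whose vertices are nodes of another tree:
its vertices, its edges, and its root (`IsRoot` holds for no vertex if the tree is empty). -/
structure Skeleton (N : Type*) where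
  verts : Set N
  Adj : N → N → Prop
  IsRoot : N → Prop

namespace RootedRankDecomposition

variable {F : Type*} [Field F] {d : ℕ} {ι : Type*} {V : ι → Submodule F (Fin d → F)}
  {N M : Type*}

/-- `T.leaves v` is `L(T)[v]`: the (indices of) members of `V` mapped to a leaf below `v`. -/
def leaves (T : RootedRankDecomposition V N) (v : N) : Set ι := {i | T.tree.Le (T.leaf i) v}

/-- The boundary space `B_v`: the intersection of the sum of the subspaces below `v` with the sum
of the remaining ones. At the root this is the zero space. -/
def boundary (T : RootedRankDecomposition V N) (v : N) : Submodule F (Fin d → F) :=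
  (⨆ i ∈ T.leaves v, V i) ⊓ (⨆ i ∈ (T.leaves v)ᶜ, V i)

/-- The width: the maximum of `dim B_v` over the non-root nodes `v`, i.e. over the edges. -/
noncomputable def width [Fintype N] (T : RootedRankDecomposition V N) : ℕ :=
  open Classical in
  (Finset.univ.filter (· ≠ T.tree.root)).sup fun v => Module.finrank F (T.boundary v)

/-- `T` has optimum width: no rooted rank decomposition of `V` has smaller width. (Every finite
tree is isomorphic to one with node set `Fin m`.) -/
def IsOptimum [Fintype N] (T : RootedRankDecomposition V N) : Prop :=
  ∀ (m : ℕ) (S : RootedRankDecomposition V (Fin m)), T.width ≤ S.width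

/-- A tree factor of `T` is a set `L(T)[t]` for a node `t`. -/
def IsTreeFactor (T : RootedRankDecomposition V N) (A : Set ι) : Prop := ∃ t, A = T.leaves t

/-- A context factor of `T` is a difference of two tree factors that is not a tree factor. -/
def IsContextFactor (T : RootedRankDecomposition V N) (A : Set ι) : Prop :=
  ¬ T.IsTreeFactor A ∧ ∃ A₁ A₂, T.IsTreeFactor A₁ ∧ T.IsTreeFactor A₂ ∧ A = A₁ \ A₂

/-- A factor of `T` is a tree factor or a context factor of `T`. -/
def IsFactor (T : RootedRankDecomposition V N) (A : Set ι) : Prop :=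
  T.IsTreeFactor A ∨ T.IsContextFactor A

/-- An `x`-factor of `T`, for a node `x` of `Tb`: a factor of `T` contained in `L(Tb)[x]`. -/
def IsNodeFactor (Tb : RootedRankDecomposition V M) (x : M) (T : RootedRankDecomposition V N)
    (A : Set ι) : Prop :=
  T.IsFactor A ∧ A ⊆ Tb.leaves x

/-- The node `v` of `T` is `x`-full, for a node `x` of `Tb`. -/
def IsFull (Tb : RootedRankDecomposition V M) (x : M) (T : RootedRankDecomposition V N)
    (v : N) : Prop :=
  T.leaves v ⊆ Tb.leaves x

/-- The node `v` of `T` is `x`-empty, for a node `x` of `Tb`. -/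
def IsEmptyAt (Tb : RootedRankDecomposition V M) (x : M) (T : RootedRankDecomposition V N)
    (v : N) : Prop :=
  T.leaves v ∩ Tb.leaves x = ∅

/-- The node `v` of `T` is `x`-mixed, for a node `x` of `Tb`. -/
def IsMixed (Tb : RootedRankDecomposition V M) (x : M) (T : RootedRankDecomposition V N)
    (v : N) : Prop :=
  ¬ IsFull Tb x T v ∧ ¬ IsEmptyAt Tb x T v

/-- `v` is an `x`-leaf point: one child is `x`-empty and the other one is `x`-full. -/
def IsLeafPoint (Tb : RootedRankDecomposition V M) (x : M) (T : RootedRankDecomposition V N)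
    (v : N) : Prop :=
  ∃ c₁ ∈ T.tree.children v, ∃ c₂ ∈ T.tree.children v,
    c₁ ≠ c₂ ∧ IsEmptyAt Tb x T c₁ ∧ IsFull Tb x T c₂

/-- `v` is an `x`-branch point: both children are `x`-mixed. -/
def IsBranchPoint (Tb : RootedRankDecomposition V M) (x : M) (T : RootedRankDecomposition V N)
    (v : N) : Prop :=
  ∃ c₁ ∈ T.tree.children v, ∃ c₂ ∈ T.tree.children v,
    c₁ ≠ c₂ ∧ IsMixed Tb x T c₁ ∧ IsMixed Tb x T c₂

/-- The vertex set of the `x`-mixed skeleton of `T`. -/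
def skeletonVerts (Tb : RootedRankDecomposition V M) (x : M) (T : RootedRankDecomposition V N) :
    Set N :=
  {v | IsLeafPoint Tb x T v ∨ IsBranchPoint Tb x T v}

/-- The `x`-mixed skeleton of `T`: two distinct vertices are joined by an edge if the path between
them in the tree of `T` has no internal node in the skeleton; the root is the vertex that is an
ancestor in `T` of all the vertices. -/
def mixedSkeleton (Tb : RootedRankDecomposition V M) (x : M) (T : RootedRankDecomposition V N) :
    Skeleton N where
  verts := skeletonVerts Tb x T
  Adj u v := u ∈ skeletonVerts Tb x T ∧ v ∈ skeletonVerts Tb x T ∧ u ≠ v ∧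
    ∃ p : T.tree.graph.Walk u v, p.IsPath ∧
      ∀ w ∈ p.support, w ∈ skeletonVerts Tb x T → w = u ∨ w = v
  IsRoot v := v ∈ skeletonVerts Tb x T ∧ ∀ u ∈ skeletonVerts Tb x T, T.tree.Le u v

end RootedRankDecomposition

/-! Let `X` be the set of members below `x`. Away from skeleton vertices, a mixed node has a single
mixed child, and what hangs off there lies entirely inside or entirely outside `X`. A path of mixed
nodes between vertices thus splits into maximal blocks alternating between the two sides; their
upper ends are the run tops (`RunTop`). `X` is the disjoint union of its blocks and of the full
children at leaf points (`exists_factor_partition`), so it suffices to bound the run tops by the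
number of skeleton vertices times a function of the width.

Alternations are removed by exchanging consecutive blocks `(v, p]` and `(p, q]`. An exchange
preserves the skeletons of all sets laminar with `X` (`sameSkeleton_swap`) and all factors that do
not cross `X` (`isFactor_swap`). It also merges the upper block with the block ending at `v`, which
creates a new such factor (`exists_new_factor_swap`). Hence exchanges come to an end
(`exists_dealternated`).

The width is controlled by `traceRank`, which is monotone along upward paths and at most twice the
connectivity of `X`. Where it is constant, connectivity is modular on increments inside and outside
`X` (`conn_add_conn_eq`), so an exchange is harmless if the connectivity at `p` is at least that at
`v` and at `q` (`width_swap_le`). Once no harmless exchange is left, connectivity has no such peak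
where `traceRank` is constant: it falls and then rises, taking each value at most twice. Its
boundedness limits the number of blocks (`card_runTop_le`). -/

/-! ### The descendant order of a rooted tree. -/

namespace RootedTreeOn

variable {N : Type*} (T : RootedTreeOn N) {u v w a b : N}

theorem le_refl (u : N) : T.Le u u := ⟨0, rfl⟩

variable {T}

theorem Le.trans (h : T.Le u v) (h' : T.Le v w) : T.Le u w := by
  obtain ⟨k, rfl⟩ := h
  obtain ⟨l, rfl⟩ := h'
  exact ⟨l + k, Function.iterate_add_apply _ _ _ _⟩

variable (T)

theorem le_parent (u : N) : T.Le u (T.parent u) := ⟨1, rfl⟩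

theorem le_root (u : N) : T.Le u T.root := T.reaches_root u

theorem iterate_parent_root (k : ℕ) : T.parent^[k] T.root = T.root :=
  Function.iterate_fixed T.parent_root k

variable {T}

theorem eq_root_of_root_le (h : T.Le T.root w) : w = T.root := by
  obtain ⟨k, rfl⟩ := h
  exact T.iterate_parent_root k

theorem Le.eq_or_parent_le (h : T.Le u w) : u = w ∨ T.Le (T.parent u) w := by
  obtain ⟨k, rfl⟩ := h
  cases k with
  | zero => exact Or.inl rfl
  | succ k => exact Or.inr ⟨k, rfl⟩

theorem Le.antisymm (h : T.Le u w) (h' : T.Le w u) : u = w := by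
  obtain ⟨a, ha⟩ := h
  obtain ⟨b, hb⟩ := h'
  have hab : T.parent^[b + a] u = u := by rw [Function.iterate_add_apply, ha, hb]
  rcases Nat.eq_zero_or_pos (b + a) with h0 | h0
  · obtain rfl : a = 0 := by omega
    exact ha
  · obtain ⟨k, hk⟩ := T.reaches_root u
    -- A cycle run through `k` times makes at least the `k` steps that lead to the root, where
    -- iteration stays.
    have h1 : T.parent^[(b + a) * k] u = u := by
      rw [Function.iterate_mul]
      exact Function.iterate_fixed hab k
    have h2 : T.parent^[(b + a) * k] u = T.root := by
      obtain ⟨l, hl⟩ := Nat.exists_eq_add_of_le (Nat.le_mul_of_pos_left k h0)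
      rw [hl, Nat.add_comm, Function.iterate_add_apply, hk, T.iterate_parent_root]
    rw [h1] at h2
    rw [← ha, h2, T.iterate_parent_root]

theorem Le.total (h : T.Le u a) (h' : T.Le u b) : T.Le a b ∨ T.Le b a := by
  obtain ⟨i, rfl⟩ := h
  obtain ⟨j, rfl⟩ := h'
  rcases Nat.le_total i j with hij | hij
  · exact Or.inl ⟨j - i, by rw [← Function.iterate_add_apply, Nat.sub_add_cancel hij]⟩
  · exact Or.inr ⟨i - j, by rw [← Function.iterate_add_apply, Nat.sub_add_cancel hij]⟩

theorem parent_ne (h : u ≠ T.root) : T.parent u ≠ u := by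
  intro h'
  obtain ⟨k, hk⟩ := T.reaches_root u
  rw [Function.iterate_fixed h' k] at hk
  exact h hk

theorem not_parent_le (h : u ≠ T.root) : ¬ T.Le (T.parent u) u :=
  fun h' => parent_ne h (h'.antisymm (T.le_parent u))

theorem Lt.ne_root (h : T.Lt u w) : u ≠ T.root := by
  rintro rfl
  exact h.2 (eq_root_of_root_le h.1).symm

theorem Lt.parent_le (h : T.Lt u w) : T.Le (T.parent u) w :=
  h.1.eq_or_parent_le.resolve_left h.2

theorem Lt.not_le (h : T.Lt u w) : ¬ T.Le w u := fun h' => h.2 (h.1.antisymm h')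

theorem root_induction {P : N → Prop} (root : P T.root)
    (step : ∀ u, u ≠ T.root → P (T.parent u) → P u) (u : N) : P u := by
  obtain ⟨k, hk⟩ := T.reaches_root u
  induction k generalizing u with
  | zero => exact (show u = T.root from hk) ▸ root
  | succ k ih =>
    by_cases hu : u = T.root
    · exact hu ▸ root
    · exact step u hu (ih _ hk)

theorem downward_induction [Finite N] {P : N → Prop}
    (step : ∀ u, (∀ w, T.Lt w u → P w) → P u) (u : N) : P u := by
  let _ : Preorder N :=
    { le := T.Le, le_refl := T.le_refl, le_trans := fun _ _ _ => Le.trans }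
  have hwf : WellFounded (T.Lt) := by
    refine Subrelation.wf ?_ (wellFounded_lt : WellFounded (α := N) (· < ·))
    exact fun {x y} h => ⟨h.1, h.not_le⟩
  exact hwf.induction u step

theorem upward_induction [Finite N] {P : N → Prop}
    (step : ∀ u, (∀ w, T.Lt u w → P w) → P u) (u : N) : P u := by
  let _ : Preorder N :=
    { le := T.Le, le_refl := T.le_refl, le_trans := fun _ _ _ => Le.trans }
  have hwf : WellFounded (fun x y => T.Lt y x) := by
    refine Subrelation.wf ?_ (wellFounded_gt : WellFounded (α := N) (· > ·))
    exact fun {x y} h => ⟨h.1, h.not_le⟩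
  exact hwf.induction u step

theorem exists_child_of_lt (h : T.Lt u w) : ∃ c ∈ T.children w, T.Le u c := by
  obtain ⟨⟨k, hk⟩, hne⟩ := h
  induction k generalizing u with
  | zero => exact absurd hk hne
  | succ k ih =>
    have hu : u ≠ T.root := Lt.ne_root ⟨⟨k + 1, hk⟩, hne⟩
    by_cases h1 : T.parent u = w
    · exact ⟨u, ⟨hu, h1⟩, T.le_refl u⟩
    · obtain ⟨c, hc, hle⟩ := ih h1 hk
      exact ⟨c, hc, (T.le_parent u).trans hle⟩

theorem lt_of_mem_children (h : u ∈ T.children w) : T.Lt u w :=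
  ⟨h.2 ▸ T.le_parent u, fun e => parent_ne h.1 (h.2.trans e.symm)⟩

theorem children_eq_of_le (ha : a ∈ T.children w) (hb : b ∈ T.children w) (h : T.Le a b) :
    a = b := by
  rcases h.eq_or_parent_le with h | h
  · exact h
  · rw [ha.2, ← hb.2] at h
    exact absurd h (not_parent_le hb.1)

theorem children_eq_of_common (ha : a ∈ T.children w) (hb : b ∈ T.children w)
    (hua : T.Le u a) (hub : T.Le u b) : a = b := by
  rcases hua.total hub with h | h
  · exact children_eq_of_le ha hb h
  · exact (children_eq_of_le hb ha h).symm

/-! ### Walks in the underlying tree -/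

/-- The only edge leaving the subtree below `c` joins `c` to its parent. -/
theorem mem_support_of_exit {c : N} (p : T.graph.Walk u v) (hu : T.Le u c) (hv : ¬ T.Le v c) :
    c ∈ p.support ∧ T.parent c ∈ p.support := by
  induction p with
  | nil => exact absurd hu hv
  | @cons x y z hxy p ih =>
    by_cases hy : T.Le y c
    · obtain ⟨h1, h2⟩ := ih hy hv
      exact ⟨List.mem_cons_of_mem _ h1, List.mem_cons_of_mem _ h2⟩
    · have hxy' : T.parent x = y ∨ T.parent y = x := by
        simpa [graph, hxy.ne] using hxy
      rcases hxy' with h | h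
      · rcases hu.eq_or_parent_le with e | e
        · subst e
          refine ⟨by simp, ?_⟩
          rw [h]
          simp
        · exact absurd (h ▸ e) hy
      · exact absurd (((T.le_parent y).trans (h ▸ T.le_refl x)).trans hu) hy

theorem exists_path_of_le (h : T.Le u v) :
    ∃ p : T.graph.Walk u v, p.IsPath ∧ ∀ w ∈ p.support, T.Le u w ∧ T.Le w v := by
  obtain ⟨k, hk⟩ := h
  induction k generalizing u with
  | zero =>
    obtain rfl : u = v := hk
    exact ⟨.nil, by simp, by simp [T.le_refl]⟩
  | succ k ih =>
    by_cases hu : u = T.root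
    · have hv : u = v := by rw [← hk, hu, T.iterate_parent_root]
      subst hv
      exact ⟨.nil, by simp, by simp [T.le_refl]⟩
    · obtain ⟨p, hp, hs⟩ := ih hk
      have hadj : T.graph.Adj u (T.parent u) := by
        simp [graph, (parent_ne hu).symm]
      refine ⟨.cons hadj p, ?_, ?_⟩
      · rw [SimpleGraph.Walk.cons_isPath_iff]
        exact ⟨hp, fun hmem => not_parent_le hu (hs u hmem).1⟩
      · intro w hw
        rw [SimpleGraph.Walk.support_cons, List.mem_cons] at hw
        rcases hw with rfl | hw
        · exact ⟨T.le_refl _, ⟨k + 1, hk⟩⟩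
        · exact ⟨(T.le_parent u).trans (hs w hw).1, (hs w hw).2⟩

/-- The join of two incomparable nodes is the parent of a node that is above only one of them. -/
theorem exists_exit (hvu : ¬ T.Le v u) :
    ∃ c, T.Le u c ∧ ¬ T.Le v c ∧ T.Le v (T.parent c) := by
  induction u using T.root_induction with
  | root => exact absurd (T.le_root v) hvu
  | step u hu ih =>
    by_cases h : T.Le v (T.parent u)
    · exact ⟨u, T.le_refl u, hvu, h⟩
    · obtain ⟨c, h1, h2⟩ := ih h
      exact ⟨c, (T.le_parent u).trans h1, h2⟩

/-- In a set of nodes that contains the joins of its incomparable members, adjacency through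
paths without internal nodes in the set is the covering relation. -/
theorem exists_path_avoiding_iff {S : Set N}
    (hS : ∀ u ∈ S, ∀ v ∈ S, ∀ c, T.Le u c → ¬ T.Le v c → T.Le v (T.parent c) → ¬ T.Le u v →
      T.parent c ∈ S)
    (hu : u ∈ S) (hv : v ∈ S) :
    (∃ p : T.graph.Walk u v, p.IsPath ∧ ∀ w ∈ p.support, w ∈ S → w = u ∨ w = v) ↔
      (T.Le u v ∧ ∀ w ∈ S, T.Le u w → T.Le w v → w = u ∨ w = v) ∨
      (T.Le v u ∧ ∀ w ∈ S, T.Le v w → T.Le w u → w = u ∨ w = v) := by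
  constructor
  · rintro ⟨p, -, hp⟩
    by_cases huv : T.Le u v
    · refine Or.inl ⟨huv, fun w hw h1 h2 => ?_⟩
      by_cases h3 : T.Le v w
      · exact Or.inr (h2.antisymm h3)
      · exact hp w (mem_support_of_exit p h1 h3).1 hw
    · by_cases hvu : T.Le v u
      · refine Or.inr ⟨hvu, fun w hw h1 h2 => ?_⟩
        by_cases h3 : T.Le u w
        · exact Or.inl (h2.antisymm h3)
        · refine hp w ?_ hw
          have := (mem_support_of_exit p.reverse h1 h3).1
          simpa using this
      -- Every walk between incomparable nodes passes through their join, which is in `S` and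
      -- differs from both.
      · obtain ⟨c, h1, h2, h3⟩ := exists_exit hvu
        have hmem := hS u hu v hv c h1 h2 h3 huv
        rcases hp _ (mem_support_of_exit p h1 h2).2 hmem with h | h
        · exact absurd (h ▸ h3) hvu
        · exact absurd (h ▸ h1.trans (T.le_parent c)) huv
  · rintro (⟨h, hw⟩ | ⟨h, hw⟩)
    · obtain ⟨p, hp, hs⟩ := exists_path_of_le h
      exact ⟨p, hp, fun w hwp hwS => hw w hwS (hs w hwp).1 (hs w hwp).2⟩
    · obtain ⟨p, hp, hs⟩ := exists_path_of_le h
      refine ⟨p.reverse, hp.reverse, fun w hwp hwS => ?_⟩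
      have hwp' : w ∈ p.support := by simpa using hwp
      exact hw w hwS (hs w hwp').1 (hs w hwp').2

end RootedTreeOn

/-! ### Exchanging two blocks of a path in a rooted tree. -/

namespace RootedTreeOn

variable {N : Type*} {T : RootedTreeOn N} {u v w p q : N}

section Swap

open Classical in
/-- The parent map after exchanging the blocks `(v, p]` and `(p, q]` of a path `v < p < q`. -/
noncomputable def swapParent (T : RootedTreeOn N) (v p q u : N) : N :=
  if u = v then T.parent p
  else if u = q then T.parent v
  else if u = p then (if q = T.root then p else T.parent q)
  else T.parent u

open Classical in
/-- The root after exchanging the blocks `(v, p]` and `(p, q]` of a path `v < p < q`. -/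
noncomputable def swapRoot (T : RootedTreeOn N) (p q : N) : N := if q = T.root then p else T.root

theorem Lt.trans (h : T.Lt u v) (h' : T.Lt v w) : T.Lt u w :=
  ⟨h.1.trans h'.1, fun e => h'.not_le (e ▸ h.1)⟩

theorem Lt.trans_le (h : T.Lt u v) (h' : T.Le v w) : T.Lt u w :=
  ⟨h.1.trans h', fun e => h.not_le (e ▸ h')⟩

theorem Le.trans_lt (h : T.Le u v) (h' : T.Lt v w) : T.Lt u w :=
  ⟨h.trans h'.1, fun e => h'.not_le (e ▸ h)⟩

theorem lt_parent (h : u ≠ T.root) : T.Lt u (T.parent u) :=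
  ⟨T.le_parent u, (parent_ne h).symm⟩

theorem swapParent_bot : T.swapParent v p q v = T.parent p := by simp [swapParent]

theorem swapParent_top (hvp : T.Lt v p) (hpq : T.Lt p q) : T.swapParent v p q q = T.parent v := by
  have := (hvp.trans hpq).2
  simp [swapParent, this.symm]

theorem swapParent_mid_root (hvp : T.Lt v p) (hpq : T.Lt p q) (h : q = T.root) :
    T.swapParent v p q p = p := by
  have h1 := hvp.2.symm
  have h2 := hpq.2
  rw [swapParent, if_neg h1, if_neg h2, if_pos rfl, if_pos h]

theorem swapParent_mid (hvp : T.Lt v p) (hpq : T.Lt p q) (h : q ≠ T.root) :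
    T.swapParent v p q p = T.parent q := by
  have h1 := hvp.2.symm
  have h2 := hpq.2
  simp [swapParent, h1, h2, h]

theorem swapParent_of_ne (hv : u ≠ v) (hp : u ≠ p) (hq : u ≠ q) :
    T.swapParent v p q u = T.parent u := by
  simp [swapParent, hv, hp, hq]

theorem swapParent_swapRoot (hvp : T.Lt v p) (hpq : T.Lt p q) :
    T.swapParent v p q (T.swapRoot p q) = T.swapRoot p q := by
  unfold swapRoot
  split_ifs with h
  · exact swapParent_mid_root hvp hpq h
  · rw [swapParent_of_ne hvp.ne_root.symm hpq.ne_root.symm (Ne.symm h), T.parent_root]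

theorem swapParent_reaches_of_no_cut (h : T.Le u w)
    (hcut : ∀ z, T.Le u z → T.Lt z w → z ≠ v ∧ z ≠ p ∧ z ≠ q) :
    ∃ k, (T.swapParent v p q)^[k] u = w := by
  obtain ⟨k, hk⟩ := h
  induction k generalizing u with
  | zero => exact ⟨0, hk⟩
  | succ k ih =>
    by_cases huw : u = w
    · exact ⟨0, huw⟩
    · obtain ⟨l, hl⟩ := ih (fun z hz => hcut z ((T.le_parent u).trans hz)) hk
      obtain ⟨h1, h2, h3⟩ := hcut u (T.le_refl u) ⟨⟨k + 1, hk⟩, huw⟩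
      exact ⟨l + 1, by rw [Function.iterate_succ_apply, swapParent_of_ne h1 h2 h3, hl]⟩

/-- The new path goes from `v` through the old `(p, q]` up to `q`, then through the old `(v, p]` up
to `p`, and on to the old parent of `q` if there is one. -/
theorem swapParent_reaches_root (hvp : T.Lt v p) (hpq : T.Lt p q) :
    ∀ u, ∃ k, (T.swapParent v p q)^[k] u = T.swapRoot p q := by
  set P := T.swapParent v p q with hP
  have trans : ∀ {a b c : N}, (∃ k, P^[k] a = b) → (∃ k, P^[k] b = c) → ∃ k, P^[k] a = c := by
    rintro a b c ⟨k, rfl⟩ ⟨l, rfl⟩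
    exact ⟨l + k, Function.iterate_add_apply _ _ _ _⟩
  have step : ∀ {a b : N}, P a = b → ∃ k, P^[k] a = b := fun h => ⟨1, h⟩
  have hqp : ∃ k, P^[k] q = p := by
    refine trans (step (swapParent_top hvp hpq)) ?_
    refine swapParent_reaches_of_no_cut hvp.parent_le fun z h1 h2 => ⟨?_, h2.2, ?_⟩
    · rintro rfl
      exact not_parent_le hvp.ne_root h1
    · rintro rfl
      exact hpq.not_le h2.1
  have hvq : ∃ k, P^[k] v = q := by
    refine trans (step (swapParent_bot)) ?_
    refine swapParent_reaches_of_no_cut hpq.parent_le fun z h1 h2 => ⟨?_, ?_, h2.2⟩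
    · rintro rfl
      exact hvp.not_le ((T.le_parent p).trans h1)
    · rintro rfl
      exact not_parent_le hpq.ne_root h1
  have hp : ∃ k, P^[k] p = T.swapRoot p q := by
    by_cases h : q = T.root
    · exact ⟨0, by simp [swapRoot, h]⟩
    · refine trans (step (swapParent_mid hvp hpq h)) ?_
      have : T.swapRoot p q = T.root := by simp [swapRoot, h]
      rw [this]
      have hn := not_parent_le h
      refine swapParent_reaches_of_no_cut (T.le_root _) fun z h1 h2 => ⟨?_, ?_, ?_⟩
      · rintro rfl
        exact hn (h1.trans (hvp.trans hpq).1)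
      · rintro rfl
        exact hn (h1.trans hpq.1)
      · rintro rfl
        exact hn h1
  refine T.root_induction ?_ fun u hu ih => ?_
  · by_cases h : q = T.root
    · exact h ▸ trans hqp hp
    · exact ⟨0, by simp [swapRoot, h]⟩
  · by_cases h1 : u = v
    · exact h1 ▸ trans hvq (trans hqp hp)
    by_cases h2 : u = p
    · exact h2 ▸ hp
    by_cases h3 : u = q
    · rw [h3]
      exact trans hqp hp
    exact trans (step (swapParent_of_ne h1 h2 h3)) ih

/-- The tree obtained by exchanging the blocks `(v, p]` and `(p, q]` of a path `v < p < q`. -/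
noncomputable def swap (hvp : T.Lt v p) (hpq : T.Lt p q) : RootedTreeOn N where
  root := T.swapRoot p q
  parent := T.swapParent v p q
  parent_root := swapParent_swapRoot hvp hpq
  reaches_root := swapParent_reaches_root hvp hpq

/-- The descendants of a node after exchanging two blocks. -/
def SwapLe (T : RootedTreeOn N) (v p q u w : N) : Prop :=
  (T.Lt v w ∧ T.Le w p ∧ (T.Le u w ∨ T.Le u q ∧ ¬ T.Le u p)) ∨
  (T.Lt p w ∧ T.Le w q ∧ (T.Le u v ∨ T.Le u w ∧ ¬ T.Le u p)) ∨
  (¬ (T.Lt v w ∧ T.Le w q) ∧ T.Le u w)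

theorem swapLe_iff_of_not_mem (h : ¬ (T.Lt v w ∧ T.Le w q)) (hpq : T.Lt p q) (hvp : T.Lt v p) :
    T.SwapLe v p q u w ↔ T.Le u w := by
  have h1 : T.Lt v w → T.Le w p → False := fun h1 h2 => h ⟨h1, h2.trans hpq.1⟩
  have h2 : T.Lt p w → T.Le w q → False := fun h1 h2 => h ⟨hvp.trans h1, h2⟩
  unfold SwapLe
  tauto

theorem swapLe_iff_of_le_mid (hvw : T.Lt v w) (hwp : T.Le w p) (hpq : T.Lt p q) :
    T.SwapLe v p q u w ↔ T.Le u w ∨ T.Le u q ∧ ¬ T.Le u p := by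
  have h2 : T.Lt p w → False := fun h => h.not_le hwp
  have h3 : T.Le w q := hwp.trans hpq.1
  unfold SwapLe
  tauto

theorem swapLe_iff_of_mid_lt (hpw : T.Lt p w) (hwq : T.Le w q) (hvp : T.Lt v p) :
    T.SwapLe v p q u w ↔ T.Le u v ∨ T.Le u w ∧ ¬ T.Le u p := by
  have h2 : ¬ T.Le w p := hpw.not_le
  have h3 : T.Lt v w := hvp.trans hpw
  unfold SwapLe
  tauto

theorem swap_position (hvp : T.Lt v p) (w : N) :
    ¬ (T.Lt v w ∧ T.Le w q) ∨ (T.Lt v w ∧ T.Le w p) ∨ (T.Lt p w ∧ T.Le w q) := by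
  by_cases h : T.Lt v w ∧ T.Le w q
  · by_cases h1 : T.Le w p
    · exact Or.inr (Or.inl ⟨h.1, h1⟩)
    · exact Or.inr (Or.inr
        ⟨⟨(hvp.1.total h.1.1).resolve_right h1, fun e => h1 (e ▸ T.le_refl p)⟩, h.2⟩)
  · exact Or.inl h

theorem Le.lt_of_ne (h : T.Le u w) (hne : u ≠ w) : T.Lt u w := ⟨h, hne⟩

theorem swapLe_refl (hvp : T.Lt v p) (hpq : T.Lt p q) (u : N) : T.SwapLe v p q u u := by
  rcases T.swap_position (q := q) hvp u with h | h | h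
  · exact (swapLe_iff_of_not_mem h hpq hvp).2 (T.le_refl u)
  · exact (swapLe_iff_of_le_mid h.1 h.2 hpq).2 (Or.inl (T.le_refl u))
  · exact (swapLe_iff_of_mid_lt h.1 h.2 hvp).2 (Or.inr ⟨T.le_refl u, h.1.not_le⟩)

theorem SwapLe.parent (hvp : T.Lt v p) (hpq : T.Lt p q) (h : T.SwapLe v p q u w) :
    T.SwapLe v p q u (T.swapParent v p q w) := by
  by_cases hwv : w = v
  · subst hwv
    rw [swapParent_bot, swapLe_iff_of_mid_lt (lt_parent hpq.ne_root) hpq.parent_le hvp]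
    exact Or.inl ((swapLe_iff_of_not_mem (fun h => h.1.2 rfl) hpq hvp).1 h)
  by_cases hwp : w = p
  · subst hwp
    rw [swapLe_iff_of_le_mid hvp (T.le_refl w) hpq] at h
    by_cases hq : q = T.root
    · rw [swapParent_mid_root hvp hpq hq, swapLe_iff_of_le_mid hvp (T.le_refl w) hpq]
      exact h
    · rw [swapParent_mid hvp hpq hq,
        swapLe_iff_of_not_mem (fun h => not_parent_le hq h.2) hpq hvp]
      rcases h with h | h
      · exact (h.trans hpq.1).trans (T.le_parent q)
      · exact h.1.trans (T.le_parent q)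
  by_cases hwq : w = q
  · subst hwq
    rw [swapLe_iff_of_mid_lt hpq (T.le_refl w) hvp] at h
    rw [swapParent_top hvp hpq, swapLe_iff_of_le_mid (lt_parent hvp.ne_root) hvp.parent_le hpq]
    exact h.imp_left fun h => h.trans (T.le_parent v)
  rw [swapParent_of_ne hwv hwp hwq]
  have hle := T.le_parent w
  rcases T.swap_position (q := q) hvp w with hw | hw | hw
  · rw [swapLe_iff_of_not_mem hw hpq hvp] at h
    rcases T.swap_position (q := q) hvp (T.parent w) with hw' | hw' | hw'
    · exact (swapLe_iff_of_not_mem hw' hpq hvp).2 (h.trans hle)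
    · exact (swapLe_iff_of_le_mid hw'.1 hw'.2 hpq).2 (Or.inl (h.trans hle))
    -- Here `w` hangs off the block `(p, q]`, so nothing below it is below `p`.
    · refine (swapLe_iff_of_mid_lt hw'.1 hw'.2 hvp).2 (Or.inr ⟨h.trans hle, fun hup => ?_⟩)
      rcases h.total hup with hwp' | hpw
      · exact hw'.1.not_le (hwp'.lt_of_ne hwp).parent_le
      · exact hw ⟨hvp.trans_le hpw, hle.trans hw'.2⟩
  · rw [swapLe_iff_of_le_mid hw.1 hw.2 hpq] at h
    rw [swapLe_iff_of_le_mid (hw.1.trans_le hle) (hw.2.lt_of_ne hwp).parent_le hpq]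
    exact h.imp_left fun h => h.trans hle
  · rw [swapLe_iff_of_mid_lt hw.1 hw.2 hvp] at h
    rw [swapLe_iff_of_mid_lt (hw.1.trans_le hle) (hw.2.lt_of_ne hwq).parent_le hvp]
    exact h.imp_right fun h => ⟨h.1.trans hle, h.2⟩

theorem SwapLe.eq_or_parent (hvp : T.Lt v p) (hpq : T.Lt p q) (h : T.SwapLe v p q u w) :
    u = w ∨ T.SwapLe v p q (T.swapParent v p q u) w := by
  have hvq := hvp.trans hpq
  have above : ∀ {z}, ¬ (T.Lt v w ∧ T.Le w q) → T.Lt v w → T.Le z q → T.Le z w :=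
    fun h1 h2 h3 => h3.trans ((h2.1.total hvq.1).resolve_left fun h => h1 ⟨h2, h⟩)
  rcases eq_or_ne u w with huw | huw
  · exact Or.inl huw
  right
  by_cases huv : u = v
  · subst huv
    rw [swapParent_bot]
    rcases T.swap_position (q := q) hvp w with hw | hw | hw
    · rw [swapLe_iff_of_not_mem hw hpq hvp] at h ⊢
      exact above hw (h.lt_of_ne huw) hpq.parent_le
    · rw [swapLe_iff_of_le_mid hw.1 hw.2 hpq]
      exact Or.inr ⟨hpq.parent_le, not_parent_le hpq.ne_root⟩
    · rw [swapLe_iff_of_mid_lt hw.1 hw.2 hvp]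
      exact Or.inr ⟨hw.1.parent_le, not_parent_le hpq.ne_root⟩
  by_cases hup : u = p
  · subst hup
    rcases T.swap_position (q := q) hvp w with hw | hw | hw
    · rw [swapLe_iff_of_not_mem hw hpq hvp] at h
      have hvw := hvp.trans_le h
      have hqw := above hw hvw (T.le_refl q)
      have hne : q ≠ w := fun e => hw ⟨hvw, e ▸ T.le_refl _⟩
      have hlt := hqw.lt_of_ne hne
      rw [swapParent_mid hvp hpq hlt.ne_root, swapLe_iff_of_not_mem hw hpq hvp]
      exact hlt.parent_le
    · rw [swapLe_iff_of_le_mid hw.1 hw.2 hpq] at h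
      rcases h with h | h
      · exact absurd (h.antisymm hw.2) huw
      · exact absurd (T.le_refl u) h.2
    · rw [swapLe_iff_of_mid_lt hw.1 hw.2 hvp] at h
      rcases h with h | h
      · exact absurd h hvp.not_le
      · exact absurd (T.le_refl u) h.2
  by_cases huq : u = q
  · subst huq
    rw [swapParent_top hvp hpq]
    rcases T.swap_position (q := u) hvp w with hw | hw | hw
    · rw [swapLe_iff_of_not_mem hw hpq hvp] at h ⊢
      exact hvq.parent_le.trans h
    · rw [swapLe_iff_of_le_mid hw.1 hw.2 hpq]
      exact Or.inl hw.1.parent_le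
    · rw [swapLe_iff_of_mid_lt hw.1 hw.2 hvp] at h
      rcases h with h | h
      · exact absurd h hvq.not_le
      · exact absurd (h.1.antisymm hw.2) huw
  rw [swapParent_of_ne huv hup huq]
  have hup' : ¬ T.Le u p → ¬ T.Le (T.parent u) p := fun h h' => h ((T.le_parent u).trans h')
  rcases T.swap_position (q := q) hvp w with hw | hw | hw
  · rw [swapLe_iff_of_not_mem hw hpq hvp] at h ⊢
    exact (h.lt_of_ne huw).parent_le
  · rw [swapLe_iff_of_le_mid hw.1 hw.2 hpq] at h ⊢
    exact h.imp (fun h => (h.lt_of_ne huw).parent_le)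
      fun h => ⟨(h.1.lt_of_ne huq).parent_le, hup' h.2⟩
  · rw [swapLe_iff_of_mid_lt hw.1 hw.2 hvp] at h ⊢
    exact h.imp (fun h => (h.lt_of_ne huv).parent_le)
      fun h => ⟨(h.1.lt_of_ne huw).parent_le, hup' h.2⟩

theorem SwapLe.eq_swapRoot (hvp : T.Lt v p) (hpq : T.Lt p q)
    (h : T.SwapLe v p q (T.swapRoot p q) w) : w = T.swapRoot p q := by
  unfold swapRoot at h ⊢
  split_ifs at h ⊢ with hq
  · rcases T.swap_position (q := q) hvp w with hw | hw | hw
    · rw [swapLe_iff_of_not_mem hw hpq hvp] at h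
      exact absurd ⟨hvp.trans_le h, hq ▸ T.le_root w⟩ hw
    · rw [swapLe_iff_of_le_mid hw.1 hw.2 hpq] at h
      rcases h with h | h
      · exact hw.2.antisymm h
      · exact absurd (T.le_refl p) h.2
    · rw [swapLe_iff_of_mid_lt hw.1 hw.2 hvp] at h
      rcases h with h | h
      · exact absurd h hvp.not_le
      · exact absurd (T.le_refl p) h.2
  · rcases h with ⟨-, -, h | h⟩ | ⟨-, -, h | h⟩ | ⟨-, h⟩
    · exact eq_root_of_root_le h
    · exact absurd (eq_root_of_root_le h.1) hq
    · exact absurd (eq_root_of_root_le h) hvp.ne_root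
    · exact eq_root_of_root_le h.1
    · exact eq_root_of_root_le h

/-- `SwapLe` is reflexive, is stable under passing to the new parent on the right and, unless its
sides are equal, on the left, and has the new root below itself only. This determines the new order.
-/
theorem swap_le_iff (hvp : T.Lt v p) (hpq : T.Lt p q) :
    (swap hvp hpq).Le u w ↔ T.SwapLe v p q u w := by
  constructor
  · rintro ⟨k, rfl⟩
    induction k with
    | zero => exact swapLe_refl hvp hpq u
    | succ k ih =>
      rw [Function.iterate_succ_apply']
      exact ih.parent hvp hpq
  · induction u using (swap hvp hpq).root_induction with
    | root =>
      intro h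
      rw [h.eq_swapRoot hvp hpq]
      exact (swap hvp hpq).le_refl _
    | step u hu ih =>
      intro h
      rcases h.eq_or_parent hvp hpq with rfl | h
      · exact (swap hvp hpq).le_refl u
      · exact ((swap hvp hpq).le_parent u).trans (ih h)

/-- The permutation is the cycle `v ↦ q ↦ p ↦ v`: as children, `q` replaces `v`, `p` replaces `q`
and `v` replaces `p`. So every node keeps its number of children. -/
theorem swap_children (hvp : T.Lt v p) (hpq : T.Lt p q) (w : N) :
    open Classical in
    (swap hvp hpq).children w = (Equiv.swap v q * Equiv.swap p q) '' T.children w := by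
  classical
  have h1 := hvp.2
  have h2 := hpq.2
  have h3 := (hvp.trans hpq).2
  have hv := hvp.ne_root
  have hp := hpq.ne_root
  ext c
  rw [Equiv.image_eq_preimage_symm]
  change (c ≠ T.swapRoot p q ∧ T.swapParent v p q c = w) ↔
    (Equiv.swap v q * Equiv.swap p q)⁻¹ c ∈ T.children w
  have e : (Equiv.swap v q * Equiv.swap p q)⁻¹ c = Equiv.swap p q (Equiv.swap v q c) := by
    simp
  rw [e]
  by_cases hcv : c = v
  · subst hcv
    rw [swapParent_bot, Equiv.swap_apply_left, Equiv.swap_apply_right]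
    have : c ≠ T.swapRoot p q := by
      unfold swapRoot
      split_ifs <;> assumption
    simp [children, hp, this]
  by_cases hcp : c = p
  · subst hcp
    rw [Equiv.swap_apply_of_ne_of_ne hcv h2, Equiv.swap_apply_left]
    by_cases hq : q = T.root
    · simp [children, hq, swapRoot]
    · rw [swapParent_mid hvp hpq hq]
      simp [children, hq, swapRoot, hp]
  by_cases hcq : c = q
  · subst hcq
    rw [swapParent_top hvp hpq, Equiv.swap_apply_right, Equiv.swap_apply_of_ne_of_ne h1 h3]
    have : c ≠ T.swapRoot p c := by
      unfold swapRoot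
      split_ifs with h
      · exact h2.symm
      · exact h
    simp [children, hv, this]
  · rw [swapParent_of_ne hcv hcp hcq, Equiv.swap_apply_of_ne_of_ne hcv hcq,
      Equiv.swap_apply_of_ne_of_ne hcp hcq]
    have : c ≠ T.swapRoot p q ↔ c ≠ T.root := by
      unfold swapRoot
      split_ifs with h
      · exact ⟨fun _ => h ▸ hcq, fun _ => hcp⟩
      · exact Iff.rfl
    simp only [children, Set.mem_ofPred_eq, this]

end Swap

end RootedTreeOn

/-! ### Leaf sets, mixed nodes and skeleton vertices. -/

namespace RootedRankDecomposition

open RootedTreeOn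

variable {F : Type*} [Field F] {d : ℕ} {ι : Type*} {V : ι → Submodule F (Fin d → F)}
  {N M : Type*}

section Leaves

variable {T : RootedRankDecomposition V N} {X C : Set ι} {u w a b c : N} {i : ι}

theorem leaves_mono (h : T.tree.Le u w) : T.leaves u ⊆ T.leaves w :=
  fun _ hi => RootedTreeOn.Le.trans hi h

theorem le_total_of_mem (hu : i ∈ T.leaves u) (hw : i ∈ T.leaves w) :
    T.tree.Le u w ∨ T.tree.Le w u :=
  RootedTreeOn.Le.total hu hw

theorem leaves_root (T : RootedRankDecomposition V N) : T.leaves T.tree.root = Set.univ :=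
  Set.eq_univ_of_forall fun _ => T.tree.le_root _

theorem isLeaf_or_children (T : RootedRankDecomposition V N) (w : N) :
    T.tree.IsLeaf w ∨ ∃ a b, a ≠ b ∧ T.tree.children w = {a, b} :=
  (T.tree.leaf_or_two_children w).imp_right Set.ncard_eq_two.1

theorem leaves_nonempty [Finite N] (T : RootedRankDecomposition V N) (w : N) :
    (T.leaves w).Nonempty := by
  induction w using T.tree.toRootedTreeOn.downward_induction with
  | step w ih =>
    rcases T.isLeaf_or_children w with h | ⟨a, b, -, hab⟩
    · refine ⟨T.leaf.symm ⟨w, h⟩, ?_⟩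
      simp [leaves, T.tree.le_refl]
    · have ha : a ∈ T.tree.children w := by simp [hab]
      have := lt_of_mem_children ha
      exact (ih a this).mono (leaves_mono this.1)

theorem mem_leaves_child (ha : a ∈ T.tree.children w) (hi : i ∈ T.leaves w) :
    ∃ c ∈ T.tree.children w, i ∈ T.leaves c := by
  refine exists_child_of_lt ⟨hi, fun e => ?_⟩
  have := (T.leaf i).2
  rw [e] at this
  exact (Set.eq_empty_iff_forall_notMem.1 this a) ha

theorem disjoint_leaves_children (ha : a ∈ T.tree.children w) (hb : b ∈ T.tree.children w)
    (hab : a ≠ b) : Disjoint (T.leaves a) (T.leaves b) :=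
  Set.disjoint_left.2 fun _ h1 h2 => hab (children_eq_of_common ha hb h1 h2)

theorem exists_sibling (ha : a ∈ T.tree.children w) :
    ∃ b ∈ T.tree.children w, a ≠ b ∧ T.leaves w = T.leaves a ∪ T.leaves b := by
  rcases T.isLeaf_or_children w with h | ⟨x, y, hxy, hc⟩
  · exact absurd ha (Set.eq_empty_iff_forall_notMem.1 h a)
  · obtain ⟨b, hb, hab, hcab⟩ : ∃ b ∈ T.tree.children w, a ≠ b ∧ T.tree.children w = {a, b} := by
      rw [hc] at ha ⊢
      rcases ha with rfl | rfl
      · exact ⟨y, by simp, hxy, rfl⟩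
      · exact ⟨x, by simp, hxy.symm, Set.pair_comm _ _⟩
    refine ⟨b, hb, hab, Set.Subset.antisymm (fun i hi => ?_) ?_⟩
    · obtain ⟨c, hc, hi⟩ := mem_leaves_child ha hi
      rw [hcab] at hc
      rcases hc with rfl | rfl
      · exact Or.inl hi
      · exact Or.inr hi
    · exact Set.union_subset (leaves_mono (lt_of_mem_children ha).1)
        (leaves_mono (lt_of_mem_children hb).1)

theorem exists_mem_diff_of_lt [Finite N] (h : T.tree.Lt u w) :
    (T.leaves w \ T.leaves u).Nonempty := by
  obtain ⟨c, hc, huc⟩ := exists_child_of_lt h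
  obtain ⟨b, hb, hcb, -⟩ := exists_sibling hc
  obtain ⟨i, hi⟩ := T.leaves_nonempty b
  exact ⟨i, leaves_mono (lt_of_mem_children hb).1 hi, fun hiu =>
    Set.disjoint_left.1 (disjoint_leaves_children hc hb hcb) (leaves_mono huc hiu) hi⟩

/-- The node `w` has leaves inside and outside of `X`. -/
def Mixed (T : RootedRankDecomposition V N) (X : Set ι) (w : N) : Prop :=
  ¬ T.leaves w ⊆ X ∧ ¬ T.leaves w ⊆ Xᶜ

theorem mixed_compl : T.Mixed Xᶜ w ↔ T.Mixed X w := by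
  simp [Mixed, and_comm]

theorem Mixed.mono (h : T.Mixed X u) (huw : T.tree.Le u w) : T.Mixed X w :=
  ⟨fun hX => h.1 ((leaves_mono huw).trans hX), fun hX => h.2 ((leaves_mono huw).trans hX)⟩

/-- A vertex of the mixed skeleton with respect to the set `X`. -/
def Vertex (T : RootedRankDecomposition V N) (X : Set ι) (w : N) : Prop :=
  ∃ a ∈ T.tree.children w, ∃ b ∈ T.tree.children w, a ≠ b ∧
    ((T.leaves a ⊆ Xᶜ ∧ T.leaves b ⊆ X) ∨ (T.Mixed X a ∧ T.Mixed X b))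

theorem vertex_compl : T.Vertex Xᶜ w ↔ T.Vertex X w := by
  have key : ∀ Y : Set ι, T.Vertex Y w → T.Vertex Yᶜ w := by
    rintro Y ⟨a, ha, b, hb, hab, h | h⟩
    · exact ⟨b, hb, a, ha, hab.symm, Or.inl ⟨by simpa using h.2, h.1⟩⟩
    · exact ⟨a, ha, b, hb, hab, Or.inr ⟨mixed_compl.2 h.1, mixed_compl.2 h.2⟩⟩
  exact ⟨fun h => by simpa using key _ h, key X⟩

theorem Vertex.mixed [Finite N] (h : T.Vertex X w) : T.Mixed X w := by
  obtain ⟨a, ha, b, hb, -, h | h⟩ := h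
  · have h1 := leaves_mono (lt_of_mem_children ha).1
    have h2 := leaves_mono (lt_of_mem_children hb).1
    obtain ⟨i, hi⟩ := T.leaves_nonempty a
    obtain ⟨j, hj⟩ := T.leaves_nonempty b
    exact ⟨fun h' => h.1 hi (h' (h1 hi)), fun h' => h' (h2 hj) (h.2 hj)⟩
  · exact h.1.mono (lt_of_mem_children ha).1

theorem not_mixed_iff : ¬ T.Mixed X w ↔ T.leaves w ⊆ X ∨ T.leaves w ⊆ Xᶜ := by
  unfold Mixed
  tauto

/-- A leaf carries one member only, so it cannot be mixed. -/
theorem Mixed.exists_children (h : T.Mixed X w) : ∃ a, a ∈ T.tree.children w := by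
  rcases T.isLeaf_or_children w with hl | ⟨a, b, -, hab⟩
  · exfalso
    have key : ∀ i ∈ T.leaves w, (T.leaf i : N) = w := by
      intro i hi
      by_contra hne
      obtain ⟨c, hc, -⟩ := exists_child_of_lt (T := T.tree.toRootedTreeOn) ⟨hi, hne⟩
      exact (Set.eq_empty_iff_forall_notMem.1 hl c) hc
    obtain ⟨i, hi, hiX⟩ := Set.not_subset.1 h.1
    obtain ⟨j, hj, hjX⟩ := Set.not_subset.1 h.2
    have : i = j := T.leaf.injective (Subtype.ext ((key i hi).trans (key j hj).symm))
    subst this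
    exact hjX hiX
  · exact ⟨a, by simp [hab]⟩

/-- A mixed node that is not a skeleton vertex has one mixed child. -/
theorem Mixed.vertex_or (h : T.Mixed X w) :
    T.Vertex X w ∨ ∃ c ∈ T.tree.children w, T.Mixed X c ∧
      (T.leaves w \ T.leaves c ⊆ X ∨ T.leaves w \ T.leaves c ⊆ Xᶜ) := by
  obtain ⟨a, ha⟩ := h.exists_children
  obtain ⟨b, hb, hab, hw⟩ := exists_sibling ha
  have hwa : T.leaves w \ T.leaves a ⊆ T.leaves b := by
    rw [hw]
    exact fun i hi => hi.1.resolve_left hi.2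
  have hwb : T.leaves w \ T.leaves b ⊆ T.leaves a := by
    rw [hw]
    exact fun i hi => hi.1.resolve_right hi.2
  by_cases h1 : T.Mixed X a
  · by_cases h2 : T.Mixed X b
    · exact Or.inl ⟨a, ha, b, hb, hab, Or.inr ⟨h1, h2⟩⟩
    · exact Or.inr ⟨a, ha, h1, (not_mixed_iff.1 h2).imp hwa.trans hwa.trans⟩
  · by_cases h2 : T.Mixed X b
    · exact Or.inr ⟨b, hb, h2, (not_mixed_iff.1 h1).imp hwb.trans hwb.trans⟩
    · left
      rcases not_mixed_iff.1 h1 with h1 | h1 <;> rcases not_mixed_iff.1 h2 with h2 | h2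
      · exact absurd (hw ▸ Set.union_subset h1 h2) h.1
      · exact ⟨b, hb, a, ha, hab.symm, Or.inl ⟨h2, h1⟩⟩
      · exact ⟨a, ha, b, hb, hab, Or.inl ⟨h1, h2⟩⟩
      · exact absurd (hw ▸ Set.union_subset h1 h2) h.2

end Leaves

/-! ### A skeleton is determined by its vertices and their order. -/

section Skeleton

variable {Tb : RootedRankDecomposition V M} {y : M} {T T' : RootedRankDecomposition V N} {w : N}

theorem isEmptyAt_iff : IsEmptyAt Tb y T w ↔ T.leaves w ⊆ (Tb.leaves y)ᶜ :=
  Set.disjoint_iff_inter_eq_empty.symm.trans Set.subset_compl_iff_disjoint_right.symm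

theorem isMixed_iff : IsMixed Tb y T w ↔ T.Mixed (Tb.leaves y) w :=
  and_congr Iff.rfl (not_congr isEmptyAt_iff)

theorem mem_skeletonVerts_iff : w ∈ skeletonVerts Tb y T ↔ T.Vertex (Tb.leaves y) w := by
  change IsLeafPoint Tb y T w ∨ IsBranchPoint Tb y T w ↔ _
  unfold IsLeafPoint IsBranchPoint Vertex
  simp only [isEmptyAt_iff, isMixed_iff, IsFull]
  constructor
  · rintro (⟨a, ha, b, hb, hab, h⟩ | ⟨a, ha, b, hb, hab, h⟩)
    · exact ⟨a, ha, b, hb, hab, Or.inl h⟩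
    · exact ⟨a, ha, b, hb, hab, Or.inr h⟩
  · rintro ⟨a, ha, b, hb, hab, h | h⟩
    · exact Or.inl ⟨a, ha, b, hb, hab, h⟩
    · exact Or.inr ⟨a, ha, b, hb, hab, h⟩

/-- Both children of the join lie above a vertex and are therefore mixed. -/
theorem vertex_join [Finite N] {X : Set ι} {u v c : N} (hu : T.Vertex X u) (hv : T.Vertex X v)
    (huc : T.tree.Le u c) (hvc : ¬ T.tree.Le v c) (hvp : T.tree.Le v (T.tree.parent c))
    (huv : ¬ T.tree.Le u v) : T.Vertex X (T.tree.parent c) := by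
  have hc : c ∈ T.tree.children (T.tree.parent c) :=
    ⟨fun e => hvc (e ▸ T.tree.le_root v), rfl⟩
  obtain ⟨b, hb, hvb⟩ := exists_child_of_lt (T := T.tree.toRootedTreeOn) (u := v)
    (w := T.tree.parent c) ⟨hvp, fun e => huv (e ▸ huc.trans (T.tree.le_parent c))⟩
  exact ⟨c, hc, b, hb, fun e => hvc (e ▸ hvb), Or.inr ⟨hu.mixed.mono huc, hv.mixed.mono hvb⟩⟩

theorem mixedSkeleton_adj_iff [Finite N] {u v : N} : (mixedSkeleton Tb y T).Adj u v ↔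
    T.Vertex (Tb.leaves y) u ∧ T.Vertex (Tb.leaves y) v ∧ u ≠ v ∧
      ((T.tree.Le u v ∧ ∀ w, T.Vertex (Tb.leaves y) w → T.tree.Le u w → T.tree.Le w v →
          w = u ∨ w = v) ∨
        (T.tree.Le v u ∧ ∀ w, T.Vertex (Tb.leaves y) w → T.tree.Le v w → T.tree.Le w u →
          w = u ∨ w = v)) := by
  change (u ∈ skeletonVerts Tb y T ∧ v ∈ skeletonVerts Tb y T ∧ u ≠ v ∧ _) ↔ _
  rw [mem_skeletonVerts_iff, mem_skeletonVerts_iff]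
  refine and_congr_right fun hu => and_congr_right fun hv => and_congr_right fun _ => ?_
  refine (exists_path_avoiding_iff (S := skeletonVerts Tb y T) ?_ (mem_skeletonVerts_iff.2 hu)
    (mem_skeletonVerts_iff.2 hv)).trans ?_
  · intro u hu v hv c h1 h2 h3 h4
    rw [mem_skeletonVerts_iff] at hu hv ⊢
    exact vertex_join hu hv h1 h2 h3 h4
  · simp only [mem_skeletonVerts_iff]

/-- As the vertices are closed under joins, adjacency is their covering relation, and the paths of
the two trees need not be compared. -/
theorem mixedSkeleton_eq [Finite N]
    (hverts : ∀ w, T'.Vertex (Tb.leaves y) w ↔ T.Vertex (Tb.leaves y) w)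
    (hle : ∀ u w, T.Vertex (Tb.leaves y) u → T.Vertex (Tb.leaves y) w →
      (T'.tree.Le u w ↔ T.tree.Le u w)) :
    mixedSkeleton Tb y T' = mixedSkeleton Tb y T := by
  have h1 : (mixedSkeleton Tb y T').verts = (mixedSkeleton Tb y T).verts := by
    ext w
    exact mem_skeletonVerts_iff.trans ((hverts w).trans mem_skeletonVerts_iff.symm)
  have h2 : (mixedSkeleton Tb y T').Adj = (mixedSkeleton Tb y T).Adj := by
    funext u v
    refine propext ?_
    rw [mixedSkeleton_adj_iff, mixedSkeleton_adj_iff]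
    simp only [hverts]
    refine and_congr_right fun hu => and_congr_right fun hv => and_congr_right fun _ => ?_
    refine or_congr (and_congr (hle u v hu hv) ?_) (and_congr (hle v u hv hu) ?_)
    · refine forall_congr' fun w => forall_congr' fun hw => ?_
      rw [hle u w hu hw, hle w v hw hv]
    · refine forall_congr' fun w => forall_congr' fun hw => ?_
      rw [hle v w hv hw, hle w u hw hu]
  have h3 : (mixedSkeleton Tb y T').IsRoot = (mixedSkeleton Tb y T).IsRoot := by
    funext v
    refine propext ?_
    change (v ∈ skeletonVerts Tb y T' ∧ ∀ u ∈ skeletonVerts Tb y T', _) ↔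
      (v ∈ skeletonVerts Tb y T ∧ ∀ u ∈ skeletonVerts Tb y T, _)
    simp only [mem_skeletonVerts_iff, hverts]
    refine and_congr_right fun hv => forall_congr' fun u => forall_congr' fun hu => ?_
    exact hle u v hu hv
  calc mixedSkeleton Tb y T'
      = ⟨(mixedSkeleton Tb y T').verts, (mixedSkeleton Tb y T').Adj,
          (mixedSkeleton Tb y T').IsRoot⟩ := rfl
    _ = _ := by rw [h1, h2, h3]

end Skeleton

/-! ### The exchange on decompositions and its leaf sets. -/

section Swap

variable {T : RootedRankDecomposition V N} {v p q u w : N}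

theorem swap_isLeaf_iff (hvp : T.tree.Lt v p) (hpq : T.tree.Lt p q) (w : N) :
    (RootedTreeOn.swap hvp hpq).IsLeaf w ↔ T.tree.IsLeaf w := by
  unfold RootedTreeOn.IsLeaf
  rw [swap_children, Set.image_eq_empty]

/-- The decomposition obtained by exchanging two consecutive blocks of a path. -/
noncomputable def swap (T : RootedRankDecomposition V N) (hvp : T.tree.Lt v p)
    (hpq : T.tree.Lt p q) : RootedRankDecomposition V N where
  tree :=
    { RootedTreeOn.swap hvp hpq with
      leaf_or_two_children := fun w => by
        rw [swap_isLeaf_iff hvp hpq, swap_children, Set.ncard_image_of_injective _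
          (Equiv.injective _)]
        exact T.tree.leaf_or_two_children w
      two_leaves := by
        simp only [swap_isLeaf_iff hvp hpq]
        exact T.tree.two_leaves }
  leaf := T.leaf.trans (Equiv.subtypeEquivRight fun w => (swap_isLeaf_iff hvp hpq w).symm)

variable (hvp : T.tree.Lt v p) (hpq : T.tree.Lt p q)

theorem swap_tree_le_iff : (T.swap hvp hpq).tree.Le u w ↔ T.tree.SwapLe v p q u w :=
  RootedTreeOn.swap_le_iff hvp hpq

theorem leaves_swap_of_not_mem (h : ¬ (T.tree.Lt v w ∧ T.tree.Le w q)) :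
    (T.swap hvp hpq).leaves w = T.leaves w :=
  Set.ext fun _ => (swap_tree_le_iff hvp hpq).trans (swapLe_iff_of_not_mem h hpq hvp)

theorem leaves_swap_of_le_mid (hvw : T.tree.Lt v w) (hwp : T.tree.Le w p) :
    (T.swap hvp hpq).leaves w = T.leaves w ∪ (T.leaves q \ T.leaves p) :=
  Set.ext fun _ => (swap_tree_le_iff hvp hpq).trans (swapLe_iff_of_le_mid hvw hwp hpq)

theorem leaves_swap_of_mid_lt (hpw : T.tree.Lt p w) (hwq : T.tree.Le w q) :
    (T.swap hvp hpq).leaves w = T.leaves v ∪ (T.leaves w \ T.leaves p) :=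
  Set.ext fun _ => (swap_tree_le_iff hvp hpq).trans (swapLe_iff_of_mid_lt hpw hwq hvp)

/-- After the exchange `p` is the top of the segment and `q` separates the blocks. -/
theorem leaves_swap_mid : (T.swap hvp hpq).leaves p = T.leaves q := by
  rw [leaves_swap_of_le_mid hvp hpq hvp (T.tree.le_refl p),
    Set.union_sdiff_cancel (leaves_mono hpq.1)]

theorem leaves_swap_top :
    (T.swap hvp hpq).leaves q = T.leaves v ∪ (T.leaves q \ T.leaves p) :=
  leaves_swap_of_mid_lt hvp hpq hpq (T.tree.le_refl q)

theorem leaves_swap_bot : (T.swap hvp hpq).leaves v = T.leaves v :=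
  leaves_swap_of_not_mem hvp hpq fun h => h.1.2 rfl

end Swap

end RootedRankDecomposition

/-! ### Exchanges preserve skeletons. -/

namespace RootedRankDecomposition

open RootedTreeOn

variable {F : Type*} [Field F] {d : ℕ} {ι : Type*} {V : ι → Submodule F (Fin d → F)}
  {N M : Type*}

section SwapSkeleton

variable {T T' : RootedRankDecomposition V N} {Y C : Set ι} {v p q b u w c : N}

theorem child_above_or_disjoint (hbw : T.tree.Lt b w) (hc : c ∈ T.tree.children w) :
    T.tree.Le b c ∨ Disjoint (T.leaves c) (T.leaves b) := by
  by_cases h : Disjoint (T.leaves c) (T.leaves b)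
  · exact Or.inr h
  · obtain ⟨i, h1, h2⟩ := Set.not_disjoint_iff.1 h
    rcases le_total_of_mem h2 h1 with h | h
    · exact Or.inl h
    · by_cases hcb : c = b
      · exact Or.inl (hcb ▸ T.tree.le_refl c)
      · have : T.tree.Le (T.tree.parent c) b := (h.lt_of_ne hcb).parent_le
        rw [hc.2] at this
        exact absurd this hbw.not_le

/-- A child that is not above `b` is empty for `Y`, and one above `b` is not full. So there is
neither a full child nor a pair of mixed ones. -/
theorem not_vertex_of_block [Finite N] (hG : T.leaves p \ T.leaves b ⊆ Yᶜ)
    (hb : ¬ T.leaves b ⊆ Y) (hbw : T.tree.Lt b w) (hwp : T.tree.Le w p) : ¬ T.Vertex Y w := by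
  have key : ∀ c ∈ T.tree.children w, T.tree.Le b c ∨ T.leaves c ⊆ Yᶜ := fun c hc =>
    (child_above_or_disjoint hbw hc).imp_right fun h i hi =>
      hG ⟨leaves_mono ((lt_of_mem_children hc).1.trans hwp) hi, Set.disjoint_left.1 h hi⟩
  rintro ⟨a, ha, a', ha', haa', h | h⟩
  · rcases key a' ha' with h1 | h1
    · exact hb ((leaves_mono h1).trans h.2)
    · obtain ⟨i, hi⟩ := T.leaves_nonempty a'
      exact h1 hi (h.2 hi)
  · have h1 := (key a ha).resolve_right h.1.2
    have h2 := (key a' ha').resolve_right h.2.2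
    exact haa' (children_eq_of_common ha ha' h1 h2)

theorem Vertex.le_of_block [Finite N] (hu : T.Vertex Y u) (hG : T.leaves p \ T.leaves b ⊆ Yᶜ)
    (hb : ¬ T.leaves b ⊆ Y) (hup : T.tree.Le u p) : T.tree.Le u b := by
  by_contra hub
  by_cases h : Disjoint (T.leaves u) (T.leaves b)
  · exact hu.mixed.2 fun i hi => hG ⟨leaves_mono hup hi, Set.disjoint_left.1 h hi⟩
  · obtain ⟨i, h1, h2⟩ := Set.not_disjoint_iff.1 h
    have hbu := (le_total_of_mem h1 h2).resolve_left hub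
    exact not_vertex_of_block hG hb ⟨hbu, fun e => hub (e ▸ T.tree.le_refl _)⟩ hup hu

theorem vertex_iff_of_children (σ : Equiv.Perm N)
    (hch : T'.tree.children w = σ '' T.tree.children w)
    (hst : ∀ c ∈ T.tree.children w, (T'.leaves (σ c) ⊆ Y ↔ T.leaves c ⊆ Y) ∧
      (T'.leaves (σ c) ⊆ Yᶜ ↔ T.leaves c ⊆ Yᶜ)) :
    T'.Vertex Y w ↔ T.Vertex Y w := by
  unfold Vertex
  rw [hch]
  simp only [Set.exists_mem_image]
  refine exists_congr fun a => and_congr_right fun ha => exists_congr fun b =>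
    and_congr_right fun hb => ?_
  simp only [Mixed, (hst a ha).1, (hst a ha).2, (hst b hb).1, (hst b hb).2, ne_eq,
    EmbeddingLike.apply_eq_iff_eq]

theorem union_status {A G : Set ι} (hA : ¬ A ⊆ Y) (hG : G ⊆ Yᶜ) :
    (A ∪ G ⊆ Y ↔ A ⊆ Y) ∧ (A ∪ G ⊆ Yᶜ ↔ A ⊆ Yᶜ) := by
  refine ⟨⟨fun h => absurd (Set.subset_union_left.trans h) hA, fun h => absurd h hA⟩, ?_⟩
  exact ⟨Set.subset_union_left.trans, fun h => Set.union_subset h hG⟩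

variable (hvp : T.tree.Lt v p) (hpq : T.tree.Lt p q)

/-- The vertices and their order are those of `T`. -/
def SameSkeleton (T T' : RootedRankDecomposition V N) (Y : Set ι) : Prop :=
  (∀ w, T'.Vertex Y w ↔ T.Vertex Y w) ∧
    ∀ u w, T.Vertex Y u → T.Vertex Y w → (T'.tree.Le u w ↔ T.tree.Le u w)

/-- Nodes of the lower block are not vertices, before or after. At the other nodes a child at most
loses members outside `Y`, and one that does still contains the leaves of `v`, so it keeps its
status. -/
theorem sameSkeleton_swap_of_lower [Finite N] (hP : T.leaves p \ T.leaves v ⊆ Yᶜ)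
    (hv : ¬ T.leaves v ⊆ Y) : SameSkeleton T (T.swap hvp hpq) Y := by
  classical
  have hnot : ∀ w, T.tree.Lt v w → T.tree.Le w p → ¬ T.Vertex Y w := fun w =>
    not_vertex_of_block hP hv
  have notY : ∀ {w}, T.tree.Le v w → ¬ T.leaves w ⊆ Y := fun h h' => hv ((leaves_mono h).trans h')
  refine ⟨fun w => ?_, fun u w hu hw => ?_⟩
  · by_cases hw : T.tree.Lt v w ∧ T.tree.Le w p
    · refine iff_of_false ?_ (hnot w hw.1 hw.2)
      refine not_vertex_of_block (b := q) (p := p) ?_ ?_ ?_ ?_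
      · rw [leaves_swap_mid, leaves_swap_top]
        rintro i ⟨h1, h2⟩
        exact hP ⟨by_contra fun h => h2 (Or.inr ⟨h1, h⟩), fun h => h2 (Or.inl h)⟩
      · rw [leaves_swap_top]
        exact fun h => hv (Set.subset_union_left.trans h)
      · refine ⟨(swap_tree_le_iff hvp hpq).2 ((swapLe_iff_of_le_mid hw.1 hw.2 hpq).2
          (Or.inr ⟨T.tree.le_refl q, hpq.not_le⟩)), ?_⟩
        rintro rfl
        exact hpq.not_le hw.2
      · exact (swap_tree_le_iff hvp hpq).2 ((swapLe_iff_of_le_mid hvp (T.tree.le_refl p) hpq).2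
          (Or.inl hw.2))
    · refine vertex_iff_of_children (Equiv.swap v q * Equiv.swap p q) 
        (swap_children hvp hpq w) fun c hc => ?_
      have hcw := lt_of_mem_children hc
      rw [Equiv.Perm.mul_apply]
      by_cases hcv : c = v
      · subst hcv
        exact absurd ⟨hcw, hc.2 ▸ hvp.parent_le⟩ hw
      by_cases hcp : c = p
      · subst hcp
        rw [Equiv.swap_apply_left, Equiv.swap_apply_right, leaves_swap_bot]
        have := union_status hv hP
        rw [Set.union_sdiff_cancel (leaves_mono hvp.1)] at this
        exact ⟨this.1.symm, this.2.symm⟩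
      by_cases hcq : c = q
      · subst hcq
        rw [Equiv.swap_apply_right, Equiv.swap_apply_of_ne_of_ne hvp.2.symm hpq.2,
          leaves_swap_mid]
        exact ⟨Iff.rfl, Iff.rfl⟩
      rw [Equiv.swap_apply_of_ne_of_ne hcp hcq, Equiv.swap_apply_of_ne_of_ne hcv hcq]
      rcases T.tree.swap_position (q := q) hvp c with h | h | h
      · rw [leaves_swap_of_not_mem hvp hpq h]
        exact ⟨Iff.rfl, Iff.rfl⟩
      · exact absurd ⟨h.1.trans hcw, hc.2 ▸ (h.2.lt_of_ne hcp).parent_le⟩ hw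
      · rw [leaves_swap_of_mid_lt hvp hpq h.1 h.2]
        have hvc := hvp.trans h.1
        refine ⟨iff_of_false (fun h' => hv (Set.subset_union_left.trans h')) (notY hvc.1), ?_⟩
        constructor
        · intro h' i hi
          by_cases hip : i ∈ T.leaves p
          · by_cases hiv : i ∈ T.leaves v
            · exact h' (Or.inl hiv)
            · exact hP ⟨hip, hiv⟩
          · exact h' (Or.inr ⟨hi, hip⟩)
        · exact fun h' => Set.union_subset ((leaves_mono hvc.1).trans h')
            (Set.sdiff_subset.trans h')
  · rw [swap_tree_le_iff]
    rcases T.tree.swap_position (q := q) hvp w with h | h | h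
    · exact swapLe_iff_of_not_mem h hpq hvp
    · exact absurd hw (hnot w h.1 h.2)
    · rw [swapLe_iff_of_mid_lt h.1 h.2 hvp]
      refine ⟨?_, fun huw => ?_⟩
      · rintro (h' | h')
        · exact h'.trans (hvp.trans h.1).1
        · exact h'.1
      · by_cases hup : T.tree.Le u p
        · exact Or.inl (hu.le_of_block hP hv hup)
        · exact Or.inr ⟨huw, hup⟩

theorem sameSkeleton_swap_of_upper [Finite N] (hQ : T.leaves q \ T.leaves p ⊆ Yᶜ)
    (hv : ¬ T.leaves v ⊆ Y) : SameSkeleton T (T.swap hvp hpq) Y := by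
  classical
  have notY : ∀ {w}, T.tree.Le v w → ¬ T.leaves w ⊆ Y := fun h h' => hv ((leaves_mono h).trans h')
  have hnot : ∀ w, T.tree.Lt p w → T.tree.Le w q → ¬ T.Vertex Y w := fun w =>
    not_vertex_of_block hQ (notY hvp.1)
  refine ⟨fun w => ?_, fun u w hu hw => ?_⟩
  · by_cases hw : T.tree.Lt p w ∧ T.tree.Le w q
    · refine iff_of_false ?_ (hnot w hw.1 hw.2)
      have hvw := hvp.trans hw.1
      -- The upper block now occupies `(v, q]`.
      refine not_vertex_of_block (b := v) (p := q) ?_ ?_ ?_ ?_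
      · rw [leaves_swap_top, leaves_swap_bot]
        rintro i ⟨h1, h2⟩
        exact hQ (h1.resolve_left h2)
      · rw [leaves_swap_bot]
        exact hv
      · exact ⟨(swap_tree_le_iff hvp hpq).2 ((swapLe_iff_of_mid_lt hw.1 hw.2 hvp).2
          (Or.inl (T.tree.le_refl v))), hvw.2⟩
      · exact (swap_tree_le_iff hvp hpq).2 ((swapLe_iff_of_mid_lt hpq (T.tree.le_refl q) hvp).2
          (Or.inr ⟨hw.2, hw.1.not_le⟩))
    · refine vertex_iff_of_children (Equiv.swap v q * Equiv.swap p q) 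
        (swap_children hvp hpq w) fun c hc => ?_
      have hcw := lt_of_mem_children hc
      rw [Equiv.Perm.mul_apply]
      by_cases hcv : c = v
      · subst hcv
        rw [Equiv.swap_apply_of_ne_of_ne hvp.2 (hvp.trans hpq).2, Equiv.swap_apply_left,
          leaves_swap_top]
        exact union_status hv hQ
      by_cases hcp : c = p
      · subst hcp
        exact absurd ⟨hcw, hc.2 ▸ hpq.parent_le⟩ hw
      by_cases hcq : c = q
      · subst hcq
        rw [Equiv.swap_apply_right, Equiv.swap_apply_of_ne_of_ne hvp.2.symm hpq.2,
          leaves_swap_mid]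
        exact ⟨Iff.rfl, Iff.rfl⟩
      rw [Equiv.swap_apply_of_ne_of_ne hcp hcq, Equiv.swap_apply_of_ne_of_ne hcv hcq]
      rcases T.tree.swap_position (q := q) hvp c with h | h | h
      · rw [leaves_swap_of_not_mem hvp hpq h]
        exact ⟨Iff.rfl, Iff.rfl⟩
      · rw [leaves_swap_of_le_mid hvp hpq h.1 h.2]
        exact union_status (notY h.1.1) hQ
      · exact absurd ⟨h.1.trans hcw, hc.2 ▸ (h.2.lt_of_ne hcq).parent_le⟩ hw
  · rw [swap_tree_le_iff]
    rcases T.tree.swap_position (q := q) hvp w with h | h | h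
    · exact swapLe_iff_of_not_mem h hpq hvp
    · rw [swapLe_iff_of_le_mid h.1 h.2 hpq]
      refine ⟨?_, Or.inl⟩
      rintro (h' | h')
      · exact h'
      · exact absurd (hu.le_of_block hQ (notY hvp.1) h'.1) h'.2
    · exact absurd hw (hnot w h.1 h.2)

theorem sameSkeleton_compl : SameSkeleton T T' Yᶜ ↔ SameSkeleton T T' Y := by
  simp only [SameSkeleton, vertex_compl]

/-- In each of the four positions, `Y` or its complement avoids one of the two blocks, and passing
to the complement does not change the vertices. -/
theorem sameSkeleton_swap [Finite N] (hP : T.leaves p \ T.leaves v ⊆ C) (hQ : T.leaves q \ T.leaves p ⊆ Cᶜ)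
    (hv : T.Mixed C v) (hY : Y ⊆ C ∨ C ⊆ Y ∨ Y ⊆ Cᶜ ∨ Cᶜ ⊆ Y) :
    SameSkeleton T (T.swap hvp hpq) Y := by
  have lower : ∀ Z : Set ι, Z ⊆ Cᶜ → SameSkeleton T (T.swap hvp hpq) Z := fun Z hZ =>
    sameSkeleton_swap_of_lower hvp hpq (hP.trans (Set.subset_compl_comm.1 hZ))
      fun h => hv.2 (h.trans hZ)
  have upper : ∀ Z : Set ι, Z ⊆ C → SameSkeleton T (T.swap hvp hpq) Z := fun Z hZ =>
    sameSkeleton_swap_of_upper hvp hpq (hQ.trans (Set.compl_subset_compl.2 hZ))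
      fun h => hv.1 (h.trans hZ)
  rcases hY with h | h | h | h
  · exact upper Y h
  · exact sameSkeleton_compl.1 (lower _ (Set.compl_subset_compl.2 h))
  · exact lower Y h
  · exact sameSkeleton_compl.1 (upper _ (Set.compl_subset_comm.1 h))

end SwapSkeleton

/-! ### Exchanges preserve the factors on one side of `C` and create a new one. -/

section SwapFactor

variable {T : RootedRankDecomposition V N} {A C : Set ι} {v p q t c : N}

/-- The exclusion of tree factors from the context factors is immaterial for being a factor, so any
difference of tree factors qualifies. -/
theorem isFactor_iff {T : RootedRankDecomposition V N} :
    T.IsFactor A ↔ (∃ t, A = T.leaves t) ∨ ∃ t₁ t₂, A = T.leaves t₁ \ T.leaves t₂ := by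
  unfold IsFactor IsContextFactor IsTreeFactor
  constructor
  · rintro (h | ⟨-, _, _, ⟨t₁, rfl⟩, ⟨t₂, rfl⟩, h⟩)
    · exact Or.inl h
    · exact Or.inr ⟨t₁, t₂, h⟩
  · rintro (h | ⟨t₁, t₂, h⟩)
    · exact Or.inl h
    · by_cases h' : ∃ t, A = T.leaves t
      · exact Or.inl h'
      · exact Or.inr ⟨h', _, _, ⟨t₁, rfl⟩, ⟨t₂, rfl⟩, h⟩

theorem sdiff_eq_exchange {A B D E : Set ι} (hDE : D ⊆ E) (hEB : E ⊆ B) :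
    A \ B = (D ∪ (A \ E)) \ (D ∪ (B \ E)) := by
  ext k
  have h1 := @hDE k
  have h2 := @hEB k
  simp only [Set.mem_sdiff, Set.mem_union]
  tauto

theorem sdiff_eq_union_sdiff_union {A B D : Set ι} (h : Disjoint A D) :
    A \ B = (A ∪ D) \ (B ∪ D) := by
  ext k
  have h1 : k ∈ A → k ∉ D := fun hA => Set.disjoint_left.1 h hA
  simp only [Set.mem_sdiff, Set.mem_union]
  tauto

/-- No node of `(v, q]` is a tree factor on one side, as it lies above the mixed node `v`. A
difference that cuts a block in its interior stays within that block, because `hbot` and `htop` put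
members of the other side next to its outer ends. Its bounding nodes are translated along the
exchange. -/
theorem isFactor_swap [Finite N] (hvp : T.tree.Lt v p) (hpq : T.tree.Lt p q)
    (hP : T.leaves p \ T.leaves v ⊆ C) (hQ : T.leaves q \ T.leaves p ⊆ Cᶜ)
    (hv : T.Mixed C v) (hbot : ∀ t, T.tree.Lt t v → ¬ T.leaves v \ T.leaves t ⊆ C)
    (htop : ∀ t, T.tree.Lt q t → ¬ T.leaves t \ T.leaves q ⊆ Cᶜ)
    (hA : T.IsFactor A) (hAC : A ⊆ C ∨ A ⊆ Cᶜ) : (T.swap hvp hpq).IsFactor A := by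
  have two : ∀ {i j}, i ∈ A → i ∈ C → j ∈ A → j ∈ Cᶜ → False := by
    intro i j h1 h2 h3 h4
    rcases hAC with h | h
    · exact h4 (h h3)
    · exact h h1 h2
  have notv : ¬ T.leaves v ⊆ A := fun h => by
    rcases hAC with h' | h'
    · exact hv.1 (h.trans h')
    · exact hv.2 (h.trans h')
  have tree : ∀ t, A = T.leaves t → (T.swap hvp hpq).IsFactor A := by
    intro t ht
    refine isFactor_iff.2 (Or.inl ⟨t, ?_⟩)
    rw [leaves_swap_of_not_mem hvp hpq, ht]
    rintro ⟨h, -⟩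
    exact notv (ht ▸ leaves_mono h.1)
  rcases isFactor_iff.1 hA with ⟨t, ht⟩ | ⟨t₁, t₂, rfl⟩
  · exact tree t ht
  by_cases hdisj : Disjoint (T.leaves t₁) (T.leaves t₂)
  · exact tree t₁ hdisj.sdiff_eq_left
  obtain ⟨i, hi₁, hi₂⟩ := Set.not_disjoint_iff.1 hdisj
  rcases le_total_of_mem hi₁ hi₂ with h12 | h21
  · refine isFactor_iff.2 (Or.inr ⟨v, v, ?_⟩)
    rw [Set.sdiff_self, Set.sdiff_eq_empty.2 (leaves_mono h12)]
  by_cases hne : t₂ = t₁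
  · refine isFactor_iff.2 (Or.inr ⟨v, v, ?_⟩)
    rw [Set.sdiff_self, hne, Set.sdiff_self]
  have hlt : T.tree.Lt t₂ t₁ := ⟨h21, hne⟩
  have sub₁ := leaves_mono hvp.1
  have sub₂ := leaves_mono hpq.1
  have comparable : T.tree.Le v t₁ → T.tree.Le t₂ v ∨ T.tree.Le v t₂ := by
    intro hvt
    by_contra hcon
    refine notv fun j hj => ⟨leaves_mono hvt hj, fun hj' => hcon (le_total_of_mem hj' hj)⟩
  refine isFactor_iff.2 (Or.inr ?_)
  rcases T.tree.swap_position (q := q) hvp t₁ with h1 | h1 | h1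
  · by_cases h2 : T.tree.Lt v t₂ ∧ T.tree.Le t₂ q
    · have hqt : T.tree.Lt q t₁ := by
        rcases h2.2.total h21 with h | h
        · exact ⟨h, fun e => h1 ⟨h2.1.trans hlt, e ▸ T.tree.le_refl _⟩⟩
        · exact absurd ⟨h2.1.trans hlt, h⟩ h1
      by_cases h2q : t₂ = q
      · subst h2q
        refine ⟨t₁, p, ?_⟩
        rw [leaves_swap_of_not_mem hvp hpq h1, leaves_swap_mid]
      · exfalso
        obtain ⟨j, hj, hjC⟩ : ∃ j, j ∈ T.leaves q \ T.leaves t₂ ∧ j ∈ Cᶜ := by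
          rcases T.tree.swap_position (q := q) hvp t₂ with h3 | h3 | h3
          · exact absurd h2 h3
          · obtain ⟨j, hj⟩ := exists_mem_diff_of_lt (T := T) hpq
            exact ⟨j, ⟨hj.1, fun h => hj.2 (leaves_mono h3.2 h)⟩, hQ hj⟩
          · obtain ⟨j, hj⟩ := exists_mem_diff_of_lt (T := T) (h3.2.lt_of_ne h2q)
            exact ⟨j, hj, hQ ⟨hj.1, fun h => hj.2 (leaves_mono h3.1.1 h)⟩⟩
        refine htop t₁ hqt fun k hk => ?_
        by_contra hkC
        exact two (i := k) (j := j) ⟨hk.1, fun h => hk.2 (leaves_mono h2.2 h)⟩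
          (not_not.1 hkC) ⟨leaves_mono hqt.1 hj.1, hj.2⟩ hjC
    · refine ⟨t₁, t₂, ?_⟩
      rw [leaves_swap_of_not_mem hvp hpq h1, leaves_swap_of_not_mem hvp hpq h2]
  · have st₁ := leaves_mono h1.2
    have key : ∀ B : Set ι, T.leaves t₁ \ B =
        (T.leaves t₁ ∪ (T.leaves q \ T.leaves p)) \ (B ∪ (T.leaves q \ T.leaves p)) := by
      exact fun B => sdiff_eq_union_sdiff_union (Set.disjoint_sdiff_right.mono_left st₁)
    rcases comparable h1.1.1 with h2 | h2
    · by_cases h2v : t₂ = v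
      · subst h2v
        refine ⟨t₁, q, ?_⟩
        rw [leaves_swap_of_le_mid hvp hpq h1.1 h1.2, leaves_swap_top]
        exact key _
      · exfalso
        obtain ⟨j, hj⟩ := exists_mem_diff_of_lt (T := T) h1.1
        refine hbot t₂ (h2.lt_of_ne h2v) fun k hk => ?_
        by_contra hkC
        exact two (i := j) (j := k) ⟨hj.1, fun h => hj.2 (leaves_mono h2 h)⟩
          (hP ⟨st₁ hj.1, hj.2⟩) ⟨leaves_mono h1.1.1 hk.1, hk.2⟩ hkC
    · by_cases h2v : t₂ = v
      · subst h2v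
        refine ⟨t₁, q, ?_⟩
        rw [leaves_swap_of_le_mid hvp hpq h1.1 h1.2, leaves_swap_top]
        exact key _
      · refine ⟨t₁, t₂, ?_⟩
        rw [leaves_swap_of_le_mid hvp hpq h1.1 h1.2,
          leaves_swap_of_le_mid hvp hpq (h2.lt_of_ne (Ne.symm h2v)) (hlt.1.trans h1.2)]
        exact key _
  · have hvt := hvp.trans h1.1
    obtain ⟨j, hj⟩ := exists_mem_diff_of_lt (T := T) h1.1
    have hjC : j ∈ Cᶜ := hQ ⟨leaves_mono h1.2 hj.1, hj.2⟩
    have notlow : ¬ T.tree.Lt t₂ p := by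
      intro h2
      have hjA : j ∈ T.leaves t₁ \ T.leaves t₂ := ⟨hj.1, fun h => hj.2 (leaves_mono h2.1 h)⟩
      rcases comparable hvt.1 with h3 | h3
      · obtain ⟨k, hk⟩ := exists_mem_diff_of_lt (T := T) hvp
        exact two (i := k) (j := j) ⟨leaves_mono h1.1.1 hk.1, fun h => hk.2 (leaves_mono h3 h)⟩
          (hP hk) hjA hjC
      · obtain ⟨k, hk⟩ := exists_mem_diff_of_lt (T := T) h2
        exact two (i := k) (j := j) ⟨leaves_mono h1.1.1 hk.1, hk.2⟩
          (hP ⟨hk.1, fun h => hk.2 (leaves_mono h3 h)⟩) hjA hjC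
    by_cases h2p : t₂ = p
    · subst h2p
      refine ⟨t₁, v, ?_⟩
      rw [leaves_swap_of_mid_lt hvp hpq h1.1 h1.2, leaves_swap_bot]
      simpa using sdiff_eq_exchange (A := T.leaves t₁) sub₁ subset_rfl
    · have hpt : T.tree.Lt p t₂ := by
        rcases comparable hvt.1 with h3 | h3
        · exact absurd (h3.trans_lt hvp) notlow
        · rcases h3.total hvp.1 with h4 | h4
          · exact absurd (h4.lt_of_ne h2p) notlow
          · exact h4.lt_of_ne (Ne.symm h2p)
      refine ⟨t₁, t₂, ?_⟩
      have st₂ := leaves_mono hpt.1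
      rw [leaves_swap_of_mid_lt hvp hpq h1.1 h1.2,
        leaves_swap_of_mid_lt hvp hpq hpt (hlt.1.trans h1.2)]
      exact sdiff_eq_exchange sub₁ st₂

/-- Exchanging two blocks merges the upper one with the block below, which yields a new factor. -/
theorem exists_new_factor_swap [Finite N] (hvp : T.tree.Lt v p) (hpq : T.tree.Lt p q)
    (hP : T.leaves p \ T.leaves v ⊆ C) (hQ : T.leaves q \ T.leaves p ⊆ Cᶜ)
    (hcv : T.tree.Lt c v) (hc : T.Mixed C c) (hcC : T.leaves v \ T.leaves c ⊆ Cᶜ) :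
    ∃ A ⊆ Cᶜ, (T.swap hvp hpq).IsFactor A ∧ ¬ T.IsFactor A := by
  set A := (T.leaves v \ T.leaves c) ∪ (T.leaves q \ T.leaves p) with hA
  have hAC : A ⊆ Cᶜ := Set.union_subset hcC hQ
  refine ⟨A, hAC, isFactor_iff.2 (Or.inr ⟨q, c, ?_⟩), fun hF => ?_⟩
  · rw [leaves_swap_top, leaves_swap_of_not_mem hvp hpq (w := c) (fun h => h.1.not_le hcv.1)]
    have sub := leaves_mono (hcv.trans hvp).1
    ext k
    have := @sub k
    simp only [hA, Set.mem_sdiff, Set.mem_union]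
    tauto
  · obtain ⟨i, hi⟩ := exists_mem_diff_of_lt (T := T) hcv
    obtain ⟨j, hj⟩ := exists_mem_diff_of_lt (T := T) hpq
    have hip : i ∈ T.leaves p := leaves_mono hvp.1 hi.1
    have above : ∀ t, A ⊆ T.leaves t → T.tree.Le p t := by
      intro t ht
      -- A node above both parts of `A` is above `p`, hence above the lower block and `c`; a factor
      -- equal to `A` would have to remove both of these but keep what lies between them.
      rcases le_total_of_mem hip (ht (Or.inl hi)) with h | h
      · exact h
      · exact absurd (leaves_mono h (ht (Or.inr hj))) hj.2
    rcases isFactor_iff.1 hF with ⟨t, ht⟩ | ⟨t₁, t₂, ht⟩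
    · refine hc.2 fun k hk => hAC ?_
      rw [ht]
      exact leaves_mono ((hcv.trans hvp).1.trans (above t ht.subset)) hk
    · have h1 : T.tree.Le p t₁ := above t₁ (ht.subset.trans Set.sdiff_subset)
      have hit : i ∉ T.leaves t₂ := (ht.subset (Or.inl hi)).2
      obtain ⟨g, hg⟩ := exists_mem_diff_of_lt (T := T) hvp
      have hgt : g ∈ T.leaves t₂ := by
        by_contra h
        exact hAC (ht.symm.subset ⟨leaves_mono h1 hg.1, h⟩) (hP hg)
      obtain ⟨k, hk⟩ := T.leaves_nonempty c
      have hkt : k ∈ T.leaves t₂ := by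
        by_contra h
        rcases ht.symm.subset ⟨leaves_mono ((hcv.trans hvp).1.trans h1) hk, h⟩ with h' | h'
        · exact h'.2 hk
        · exact h'.2 (leaves_mono (hcv.trans hvp).1 hk)
      rcases le_total_of_mem hkt (leaves_mono hcv.1 hk) with h | h
      · exact hg.2 (leaves_mono h hgt)
      · exact hit (leaves_mono h hi.1)

end SwapFactor

end RootedRankDecomposition

/-! ### Connectivity and traces on the boundary of a set. -/

section Connectivity

variable {F : Type*} [Field F] {d : ℕ} {ι : Type*} (V : ι → Submodule F (Fin d → F))

/-- The sum of the members of `V` with index in `S`. -/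
def spanOf (S : Set ι) : Submodule F (Fin d → F) := ⨆ i ∈ S, V i

/-- The intersection of the sum over `S` with the sum over its complement. -/
def boundaryOf (S : Set ι) : Submodule F (Fin d → F) := spanOf V S ⊓ spanOf V Sᶜ

/-- The connectivity function of the arrangement `V`. -/
noncomputable def conn (S : Set ι) : ℕ := Module.finrank F (boundaryOf V S)

/-- The position of the trace of `S` on `X` relative to the boundary of `X`; it is monotone
in `S`. -/
noncomputable def traceRank (X S : Set ι) : ℕ :=
  Module.finrank F ↥(spanOf V (S ∩ X) ⊓ boundaryOf V X) +
    (conn V X - Module.finrank F ↥(spanOf V (Sᶜ ∩ X) ⊓ boundaryOf V X))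

variable {V} {S S' X C L U : Set ι}

theorem spanOf_mono (h : S ⊆ S') : spanOf V S ≤ spanOf V S' := biSup_mono h

theorem spanOf_union : spanOf V (S ∪ S') = spanOf V S ⊔ spanOf V S' := iSup_union

theorem conn_add (S : Set ι) : conn V S + Module.finrank F (spanOf V Set.univ) =
    Module.finrank F (spanOf V S) + Module.finrank F (spanOf V Sᶜ) := by
  rw [← Submodule.finrank_sup_add_finrank_inf_eq, ← spanOf_union, Set.union_compl_self, add_comm]
  rfl

theorem conn_univ : conn V Set.univ = 0 := by
  have h : spanOf V ∅ = ⊥ := by simp [spanOf]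
  rw [conn, boundaryOf, Set.compl_univ, h, inf_bot_eq, finrank_bot]

theorem trace_eq_of_le_finrank (hS : S ⊆ S')
    (h : Module.finrank F ↥(spanOf V (S' ∩ X) ⊓ boundaryOf V X) ≤
      Module.finrank F ↥(spanOf V (S ∩ X) ⊓ boundaryOf V X)) :
    spanOf V (S ∩ X) ⊓ boundaryOf V X = spanOf V (S' ∩ X) ⊓ boundaryOf V X :=
  Submodule.eq_of_le_of_finrank_le
    (inf_le_inf_right _ (spanOf_mono (Set.inter_subset_inter_left _ hS))) h

theorem finrank_trace_mono (hS : S ⊆ S') :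
    Module.finrank F ↥(spanOf V (S ∩ X) ⊓ boundaryOf V X) ≤
      Module.finrank F ↥(spanOf V (S' ∩ X) ⊓ boundaryOf V X) :=
  Submodule.finrank_mono (inf_le_inf_right _ (spanOf_mono (Set.inter_subset_inter_left _ hS)))

theorem finrank_trace_le : Module.finrank F ↥(spanOf V (S ∩ X) ⊓ boundaryOf V X) ≤ conn V X :=
  Submodule.finrank_mono inf_le_right

theorem traceRank_le : traceRank V X S ≤ 2 * conn V X := by
  have := finrank_trace_le (V := V) (S := S) (X := X)
  unfold traceRank
  omega

theorem traceRank_mono (hS : S ⊆ S') : traceRank V X S ≤ traceRank V X S' := by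
  have h1 := finrank_trace_mono (V := V) (X := X) hS
  have h2 := finrank_trace_mono (V := V) (X := X) (Set.compl_subset_compl.2 hS)
  unfold traceRank
  omega

/-- `S` and its complement have the same traces on the boundary of `X` as `S'` and its
complement. -/
def SameTrace (V : ι → Submodule F (Fin d → F)) (X S S' : Set ι) : Prop :=
  spanOf V (S ∩ X) ⊓ boundaryOf V X = spanOf V (S' ∩ X) ⊓ boundaryOf V X ∧
    spanOf V (Sᶜ ∩ X) ⊓ boundaryOf V X = spanOf V (S'ᶜ ∩ X) ⊓ boundaryOf V X

/-- Both summands of `traceRank` are monotone, so equality at the ends freezes each of them in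
between, and nested subspaces of equal dimension coincide. -/
theorem sameTrace_of_traceRank_eq (hLS : L ⊆ S) (hSS' : S ⊆ S') (hSU : S' ⊆ U)
    (h : traceRank V X L = traceRank V X U) : SameTrace V X S S' := by
  have h0 : traceRank V X S = traceRank V X S' := le_antisymm (traceRank_mono hSS')
    (by rw [← traceRank_mono (V := V) (X := X) hLS |>.antisymm
          ((traceRank_mono (hSS'.trans hSU)).trans h.symm.le), h]; exact traceRank_mono hSU)
  have h1 := finrank_trace_mono (V := V) (X := X) hSS'
  have h2 := finrank_trace_mono (V := V) (X := X) (Set.compl_subset_compl.2 hSS')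
  have h3 := finrank_trace_le (V := V) (S := Sᶜ) (X := X)
  unfold traceRank at h0
  exact ⟨trace_eq_of_le_finrank hSS' (by omega),
    (trace_eq_of_le_finrank (Set.compl_subset_compl.2 hSS') (by omega)).symm⟩

/-- The spans of the parts inside and outside `X` meet within the boundary of `X`, so the inside
part affects the correction term only through its trace. -/
theorem finrank_span_split (X S : Set ι) : Module.finrank F (spanOf V S) +
      Module.finrank F ↥((spanOf V (S ∩ X) ⊓ boundaryOf V X) ⊓ spanOf V (S ∩ Xᶜ)) =
    Module.finrank F (spanOf V (S ∩ X)) + Module.finrank F (spanOf V (S ∩ Xᶜ)) := by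
  have h : (spanOf V (S ∩ X) ⊓ boundaryOf V X) ⊓ spanOf V (S ∩ Xᶜ) =
      spanOf V (S ∩ X) ⊓ spanOf V (S ∩ Xᶜ) := by
    refine le_antisymm (inf_le_inf_right _ inf_le_left) (le_inf (le_inf inf_le_left ?_) inf_le_right)
    exact inf_le_inf (spanOf_mono Set.inter_subset_right) (spanOf_mono Set.inter_subset_right)
  have key := Submodule.finrank_sup_add_finrank_inf_eq (spanOf V (S ∩ X)) (spanOf V (S ∩ Xᶜ))
  rw [← spanOf_union, Set.inter_union_compl] at key
  rw [h]
  exact key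

/-- By equality of the traces, `A₁` and `A₂` have the same correction term in `finrank_span_split`,
and so do `B₁` and `B₂`; the remaining terms cancel. -/
theorem finrank_span_exchange {A₁ A₂ B₁ B₂ : Set ι}
    (h₁ : A₁ ∩ X = B₁ ∩ X) (h₂ : A₂ ∩ X = B₂ ∩ X) (h₃ : A₁ ∩ Xᶜ = A₂ ∩ Xᶜ)
    (h₄ : B₁ ∩ Xᶜ = B₂ ∩ Xᶜ)
    (h : spanOf V (A₁ ∩ X) ⊓ boundaryOf V X = spanOf V (A₂ ∩ X) ⊓ boundaryOf V X) :
    Module.finrank F (spanOf V A₁) + Module.finrank F (spanOf V B₂) =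
      Module.finrank F (spanOf V A₂) + Module.finrank F (spanOf V B₁) := by
  have e₁ := finrank_span_split (V := V) X A₁
  have e₂ := finrank_span_split (V := V) X A₂
  have e₃ := finrank_span_split (V := V) X B₁
  have e₄ := finrank_span_split (V := V) X B₂
  rw [← h₁, ← h₄.symm] at e₃
  rw [← h₂, ← h₄] at e₄
  rw [← h₃, ← h] at e₂
  rw [← h] at e₄
  rw [← h₄] at e₃
  omega

theorem conn_exchange {A₁ A₂ B₁ B₂ : Set ι}
    (h₁ : A₁ ∩ X = B₁ ∩ X) (h₂ : A₂ ∩ X = B₂ ∩ X) (h₃ : A₁ ∩ Xᶜ = A₂ ∩ Xᶜ)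
    (h₄ : B₁ ∩ Xᶜ = B₂ ∩ Xᶜ) (h : SameTrace V X A₁ A₂) :
    conn V A₁ + conn V B₂ = conn V A₂ + conn V B₁ := by
  have key : ∀ {A B Z : Set ι}, A ∩ Z = B ∩ Z → Aᶜ ∩ Z = Bᶜ ∩ Z := by
    intro A B Z hAB
    ext i
    have := Set.ext_iff.1 hAB i
    simp only [Set.mem_inter_iff, Set.mem_compl_iff] at this ⊢
    tauto
  have e₁ := finrank_span_exchange h₁ h₂ h₃ h₄ h.1
  have e₂ := finrank_span_exchange (key h₁) (key h₂) (key h₃) (key h₄) h.2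
  have c₁ := conn_add (V := V) A₁
  have c₂ := conn_add (V := V) A₂
  have c₃ := conn_add (V := V) B₁
  have c₄ := conn_add (V := V) B₂
  omega

/-- Modularity of the connectivity function on pairs of increments inside and outside of `X`. -/
theorem conn_add_conn_eq {A P B : Set ι} (hXC : X = C ∨ X = Cᶜ) (hAP : A ⊆ P) (hPB : P ⊆ B)
    (hP : P \ A ⊆ C) (hB : B \ P ⊆ Cᶜ) (hLA : L ⊆ A) (hBU : B ⊆ U)
    (h : traceRank V X L = traceRank V X U) :
    conn V A + conn V B = conn V P + conn V (A ∪ (B \ P)) := by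
  have sA : A ⊆ A ∪ (B \ P) := Set.subset_union_left
  have sB : A ∪ (B \ P) ⊆ B := Set.union_subset (hAP.trans hPB) Set.sdiff_subset
  have eq₁ : A ∩ Cᶜ = P ∩ Cᶜ := by
    ext i
    have h1 := @hAP i
    have h2 := @hP i
    simp only [Set.mem_inter_iff, Set.mem_sdiff, Set.mem_compl_iff] at *
    tauto
  have eq₂ : P ∩ C = B ∩ C := by
    ext i
    have h1 := @hPB i
    have h2 := @hB i
    simp only [Set.mem_inter_iff, Set.mem_sdiff, Set.mem_compl_iff] at *
    tauto
  have eq₃ : A ∩ C = (A ∪ (B \ P)) ∩ C := by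
    ext i
    have h2 := @hB i
    simp only [Set.mem_inter_iff, Set.mem_sdiff, Set.mem_compl_iff, Set.mem_union] at *
    tauto
  have eq₄ : (A ∪ (B \ P)) ∩ Cᶜ = B ∩ Cᶜ := by
    ext i
    have h1 := @hAP i
    have h2 := @hP i
    have h3 := @hPB i
    simp only [Set.mem_inter_iff, Set.mem_sdiff, Set.mem_compl_iff, Set.mem_union] at *
    tauto
  -- The increment lying in `X` is `P \ A` in the first case and `B \ P` in the second.
  rcases hXC with rfl | rfl
  · exact conn_exchange eq₃ eq₂ eq₁ eq₄
      (sameTrace_of_traceRank_eq hLA hAP (hPB.trans hBU) h)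
  · have := conn_exchange (X := Cᶜ) (A₁ := A) (A₂ := A ∪ (B \ P)) (B₁ := P) (B₂ := B) eq₁ eq₄
      (by simpa using eq₃) (by simpa using eq₂)
      (sameTrace_of_traceRank_eq hLA sA (sB.trans hBU) h)
    omega

end Connectivity

/-! ### The width under an exchange. -/

namespace RootedRankDecomposition

open RootedTreeOn

variable {F : Type*} [Field F] {d : ℕ} {ι : Type*} {V : ι → Submodule F (Fin d → F)}
  {N M : Type*}

theorem width_le_iff [Fintype N] {T : RootedRankDecomposition V N} {k : ℕ} :
    T.width ≤ k ↔ ∀ w, conn V (T.leaves w) ≤ k := by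
  classical
  unfold width
  rw [Finset.sup_le_iff]
  refine ⟨fun h w => ?_, fun h w _ => h w⟩
  by_cases hw : w = T.tree.root
  · rw [hw, leaves_root, conn_univ]
    exact Nat.zero_le k
  · exact h w (by simpa using hw)

theorem conn_leaves_le_width [Fintype N] (T : RootedRankDecomposition V N) (w : N) :
    conn V (T.leaves w) ≤ T.width :=
  width_le_iff.1 le_rfl w

/-- By modularity the connectivity at a node `w` of the lower block changes by that of `q` minus
that of `p`, and in the upper block by that of `v` minus that of `p`. -/
theorem width_swap_le [Fintype N] {T : RootedRankDecomposition V N} {v p q : N} {X C : Set ι}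
    (hvp : T.tree.Lt v p) (hpq : T.tree.Lt p q) (hXC : X = C ∨ X = Cᶜ)
    (hP : T.leaves p \ T.leaves v ⊆ C) (hQ : T.leaves q \ T.leaves p ⊆ Cᶜ)
    (h : traceRank V X (T.leaves v) = traceRank V X (T.leaves q))
    (hv : conn V (T.leaves v) ≤ conn V (T.leaves p))
    (hq : conn V (T.leaves q) ≤ conn V (T.leaves p)) : (T.swap hvp hpq).width ≤ T.width := by
  refine width_le_iff.2 fun w => ?_
  have hw := T.conn_leaves_le_width w
  have sv := leaves_mono hvp.1
  have sp := leaves_mono hpq.1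
  rcases T.tree.swap_position (q := q) hvp w with h1 | h1 | h1
  · rwa [leaves_swap_of_not_mem hvp hpq h1]
  · rw [leaves_swap_of_le_mid hvp hpq h1.1 h1.2]
    have sw := leaves_mono h1.1.1
    have := conn_add_conn_eq hXC (leaves_mono h1.2) sp
      ((Set.sdiff_subset_sdiff_right sw).trans hP) hQ sw subset_rfl h
    omega
  · rw [leaves_swap_of_mid_lt hvp hpq h1.1 h1.2]
    have sw := leaves_mono h1.2
    have := conn_add_conn_eq hXC sv (leaves_mono h1.1.1) hP
      ((Set.sdiff_subset_sdiff_left sw).trans hQ) subset_rfl sw h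
    omega

end RootedRankDecomposition

/-! ### Run tops and the chain they form along a path. -/

namespace RootedRankDecomposition

open RootedTreeOn

variable {F : Type*} [Field F] {d : ℕ} {ι : Type*} {V : ι → Submodule F (Fin d → F)}
  {N M : Type*}

section RunTop

variable {T : RootedRankDecomposition V N} {r r' t c u w : N} {X C D : Set ι}

/-- The top node of a maximal path along which only members of `C` are attached. -/
def RunTop (T : RootedRankDecomposition V N) (C : Set ι) (r : N) : Prop :=
  (∃ c, T.tree.Lt c r ∧ T.Mixed C c ∧ T.leaves r \ T.leaves c ⊆ C) ∧
    ∀ t, T.tree.Lt r t → ¬ T.leaves t \ T.leaves r ⊆ C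

/-- A member below `c` and outside `C` must be below `t` as well. -/
theorem le_total_of_sdiff_subset (hc : T.Mixed C c) (hcr : T.tree.Le c r)
    (h : T.leaves r \ T.leaves t ⊆ C) : T.tree.Le c t ∨ T.tree.Le t c := by
  obtain ⟨i, hi, hiC⟩ := Set.not_subset.1 hc.1
  refine le_total_of_mem hi ?_
  by_contra hit
  exact hiC (h ⟨leaves_mono hcr hi, hit⟩)

/-- Some member below `r` but not below the higher of `c` and `t` would be both inside and outside
`C`. So a block lies on one side only. -/
theorem not_sdiff_subset_compl [Finite N] (hcr : T.tree.Lt c r) (hc : T.Mixed C c)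
    (h : T.leaves r \ T.leaves c ⊆ C) (htr : T.tree.Lt t r) :
    ¬ T.leaves r \ T.leaves t ⊆ Cᶜ := by
  intro h'
  rcases le_total_of_sdiff_subset (mixed_compl.2 hc) hcr.1 h' with hct | htc
  · obtain ⟨i, hi⟩ := exists_mem_diff_of_lt (T := T) htr
    exact h' hi (h ⟨hi.1, fun hic => hi.2 (leaves_mono hct hic)⟩)
  · obtain ⟨i, hi⟩ := exists_mem_diff_of_lt (T := T) hcr
    exact h' ⟨hi.1, fun hit => hi.2 (leaves_mono htc hit)⟩ (h hi)

theorem RunTop.mixed (h : T.RunTop C r) : T.Mixed C r := by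
  obtain ⟨⟨c, hcr, hc, -⟩, -⟩ := h
  exact hc.mono hcr.1

theorem RunTop.not_compl [Finite N] (h : T.RunTop C r) : ¬ T.RunTop Cᶜ r := by
  obtain ⟨⟨c, hcr, hc, hC⟩, -⟩ := h
  rintro ⟨⟨t, htr, -, hC'⟩, -⟩
  exact not_sdiff_subset_compl hcr hc hC htr hC'

theorem exists_highest_extension [Finite N] (h : T.leaves t \ T.leaves r ⊆ D) :
    ∃ r₁, T.tree.Le t r₁ ∧ T.leaves r₁ \ T.leaves r ⊆ D ∧
      ∀ t', T.tree.Lt r₁ t' → ¬ T.leaves t' \ T.leaves r₁ ⊆ D := by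
  induction t using T.tree.toRootedTreeOn.upward_induction with
  | step t ih =>
    by_cases h1 : ∃ t', T.tree.Lt t t' ∧ T.leaves t' \ T.leaves t ⊆ D
    · obtain ⟨t', htt', ht'⟩ := h1
      obtain ⟨r₁, h2, h3⟩ := ih t' htt' fun i hi => by
        by_cases hit : i ∈ T.leaves t
        · exact h ⟨hit, hi.2⟩
        · exact ht' ⟨hi.1, hit⟩
      exact ⟨r₁, htt'.1.trans h2, h3⟩
    · push Not at h1
      exact ⟨t, T.tree.le_refl t, h, h1⟩

/-- Consecutive run tops along a path. -/
def NextTop (T : RootedRankDecomposition V N) (X : Set ι) (r r' : N) : Prop :=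
  ∃ C, (X = C ∨ X = Cᶜ) ∧ T.tree.Lt r r' ∧ T.RunTop C r ∧ T.RunTop Cᶜ r' ∧
    T.leaves r' \ T.leaves r ⊆ Cᶜ

/-- Descending from a mixed non-vertex to its only mixed child loses no vertex. -/
theorem Mixed.exists_highest_vertex [Finite N] (h : T.Mixed X r) :
    ∃ s, T.Vertex X s ∧ T.tree.Le s r ∧ ∀ u, T.Vertex X u → T.tree.Le u r → T.tree.Le u s := by
  induction r using T.tree.toRootedTreeOn.downward_induction with
  | step r ih =>
    by_cases hr : T.Vertex X r
    · exact ⟨r, hr, T.tree.le_refl r, fun _ _ h => h⟩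
    · obtain ⟨c, hc, hcm, hrc⟩ := h.vertex_or.resolve_left hr
      have hcr := lt_of_mem_children hc
      obtain ⟨s, hs, hsc, hmax⟩ := ih c hcr hcm
      refine ⟨s, hs, hsc.trans hcr.1, fun u hu hur => hmax u hu ?_⟩
      have hur' : T.tree.Lt u r := ⟨hur, fun e => hr (e ▸ hu)⟩
      have hcomp : T.tree.Le u c ∨ T.tree.Le c u := by
        rcases hrc with h | h
        · exact le_total_of_sdiff_subset hu.mixed hur h
        · exact le_total_of_sdiff_subset (mixed_compl.2 hu.mixed) hur h
      rcases hcomp with h | h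
      · exact h
      · by_cases hcu : c = u
        · exact hcu ▸ T.tree.le_refl c
        · have := (h.lt_of_ne hcu).parent_le
          rw [hc.2] at this
          exact absurd this hur'.not_le

/-- The parent of a run top `r` is no vertex, so what it adds is on one side, and by maximality of
the block at `r` on the other side than that block. Extending this as far up as possible gives the
next run top. -/
theorem transGen_nextTop [Finite N] {C C' : Set ι} (hC : X = C ∨ X = Cᶜ)
    (hC' : X = C' ∨ X = C'ᶜ) (hr : T.RunTop C r) (hr' : T.RunTop C' r') (hrr' : T.tree.Lt r r')
    (hv : ∀ w, T.tree.Lt r w → T.tree.Le w r' → ¬ T.Vertex X w) :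
    Relation.TransGen (T.NextTop X) r r' := by
  induction r using T.tree.toRootedTreeOn.upward_induction generalizing C with
  | step r ih =>
    have mixC : ∀ {w}, T.Mixed X w ↔ T.Mixed C w := by
      intro w
      rcases hC with rfl | rfl
      · exact Iff.rfl
      · exact mixed_compl
    have hrw := lt_parent hrr'.ne_root
    have hrch : r ∈ T.tree.children (T.tree.parent r) := ⟨hrr'.ne_root, rfl⟩
    obtain ⟨c, hc, hcm, hcw⟩ := ((mixC.2 (hr.mixed.mono hrw.1)).vertex_or).resolve_left
      (hv _ hrw hrr'.parent_le)
    have hcr : c = r := by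
      have hcomp : T.tree.Le r c ∨ T.tree.Le c r := by
        have hrm := mixC.2 hr.mixed
        rcases hcw with h | h
        · exact le_total_of_sdiff_subset hrm hrw.1 h
        · exact le_total_of_sdiff_subset (mixed_compl.2 hrm) hrw.1 h
      rcases hcomp with h | h
      · exact (children_eq_of_le hrch hc h).symm
      · exact children_eq_of_le hc hrch h
    subst hcr
    have hwC : T.leaves (T.tree.parent c) \ T.leaves c ⊆ Cᶜ := by
      have hn := hr.2 _ hrw
      rcases hC with rfl | rfl
      · exact hcw.resolve_left hn
      · rw [compl_compl] at hcw
        exact hcw.resolve_right hn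
    obtain ⟨r₁, h1, h2, h3⟩ := exists_highest_extension hwC
    have hcr₁ : T.tree.Lt c r₁ := hrw.trans_le h1
    have htop : T.RunTop Cᶜ r₁ := ⟨⟨c, hcr₁, mixed_compl.2 hr.mixed, h2⟩, h3⟩
    have hnext : T.NextTop X c r₁ := ⟨C, hC, hcr₁, hr, htop, h2⟩
    -- If the new block went beyond `r'`, its part below `r'` or its part above `r'` would
    -- contradict that `r'` is a run top for `C'`.
    have hle : T.tree.Le r₁ r' := by
      by_contra hnle
      have hlt : T.tree.Lt r' r₁ := ⟨(hcr₁.1.total hrr'.1).resolve_left hnle,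
        fun e => hnle (e ▸ T.tree.le_refl _)⟩
      have hCC' : C' = C ∨ C' = Cᶜ := by
        rcases hC with rfl | rfl <;> rcases hC' with h | h
        · exact Or.inl h.symm
        · exact Or.inr (by rw [h, compl_compl])
        · exact Or.inr h.symm
        · exact Or.inl (compl_injective h.symm)
      rcases hCC' with rfl | rfl
      · obtain ⟨⟨b, hb, hbm, hbC⟩, -⟩ := hr'
        exact not_sdiff_subset_compl hb hbm hbC hrr'
          ((Set.sdiff_subset_sdiff_left (leaves_mono hlt.1)).trans h2)
      · exact hr'.2 r₁ hlt ((Set.sdiff_subset_sdiff_right (leaves_mono hrr'.1)).trans h2)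
    by_cases heq : r₁ = r'
    · exact heq ▸ .single hnext
    · refine .head hnext (ih r₁ hcr₁ (C := Cᶜ) ?_ htop ⟨hle, heq⟩ fun w hw =>
        hv w (hcr₁.trans hw))
      rw [compl_compl]
      exact hC.symm

theorem NextTop.lt (h : T.NextTop X r r') : T.tree.Lt r r' := h.choose_spec.2.1

theorem lt_of_transGen_nextTop (h : Relation.TransGen (T.NextTop X) r r') : T.tree.Lt r r' := by
  induction h with
  | single h => exact h.lt
  | tail _ h ih => exact ih.trans h.lt

end RunTop

/-! ### Exchanging blocks until every exchange fails its connectivity test. -/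

section Dealternation

variable {T : RootedRankDecomposition V N} {X C : Set ι}

/-- No exchange of consecutive blocks is possible without increasing the width. -/
def Dealternated (T : RootedRankDecomposition V N) (X : Set ι) : Prop :=
  ∀ v p q, T.NextTop X v p → T.NextTop X p q →
    traceRank V X (T.leaves v) = traceRank V X (T.leaves q) →
    conn V (T.leaves p) < conn V (T.leaves v) ∨ conn V (T.leaves p) < conn V (T.leaves q)

/-- The factors that do not cross `X`. -/
def pureFactors (T : RootedRankDecomposition V N) (X : Set ι) : Set (Set ι) :=
  {A | T.IsFactor A ∧ (A ⊆ X ∨ A ⊆ Xᶜ)}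

theorem subset_or_of_eq_or {A : Set ι} (h : X = C ∨ X = Cᶜ) :
    A ⊆ C ∨ A ⊆ Cᶜ ↔ A ⊆ X ∨ A ⊆ Xᶜ := by
  rcases h with rfl | rfl
  · exact Iff.rfl
  · rw [compl_compl, or_comm]

theorem exists_swap_of_not_dealternated [Fintype N] (h : ¬ T.Dealternated X) :
    ∃ T' : RootedRankDecomposition V N, T'.width ≤ T.width ∧
      (∀ Y, Y ⊆ X ∨ X ⊆ Y ∨ Y ⊆ Xᶜ → SameSkeleton T T' Y) ∧
      T.pureFactors X ⊂ T'.pureFactors X := by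
  unfold Dealternated at h
  push Not at h
  obtain ⟨v, p, q, ⟨D, hD, hvp, hv, hp, hP⟩, ⟨C, hC, hpq, hp', hq, hQ⟩, htr, hc1, hc2⟩ := h
  -- The sides alternate, because `p` is not a run top for both.
  have hDC : D = Cᶜ := by
    have h1 : D = C ∨ D = Cᶜ := by
      rcases hD with rfl | rfl <;> rcases hC with h | h
      · exact Or.inl h
      · exact Or.inr h
      · exact Or.inr (by rw [← h, compl_compl])
      · exact Or.inl (compl_injective h)
    rcases h1 with rfl | h1
    · exact absurd hp hp'.not_compl
    · exact h1
  subst hDC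
  rw [compl_compl] at hP hp
  obtain ⟨c, hcv, hcm, hcC⟩ := hv.1
  have hbot : ∀ t, T.tree.Lt t v → ¬ T.leaves v \ T.leaves t ⊆ C := fun t ht h =>
    not_sdiff_subset_compl hcv hcm hcC ht (by rwa [compl_compl])
  have hvm := mixed_compl.1 hv.mixed
  refine ⟨T.swap hvp hpq, width_swap_le hvp hpq hC hP hQ htr hc1 hc2, fun Y hY => ?_, ?_⟩
  · refine sameSkeleton_swap hvp hpq hP hQ hvm ?_
    rcases hC with rfl | rfl
    · tauto
    · rw [compl_compl] at hY
      tauto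
  · refine Set.ssubset_iff_of_subset ?_ |>.2 ?_
    · rintro A ⟨hA, hAX⟩
      exact ⟨isFactor_swap hvp hpq hP hQ hvm hbot hq.2 hA ((subset_or_of_eq_or hC).2 hAX), hAX⟩
    · obtain ⟨A, hAC, hA, hA'⟩ := exists_new_factor_swap hvp hpq hP hQ hcv (mixed_compl.1 hcm) hcC
      exact ⟨A, ⟨hA, (subset_or_of_eq_or hC).1 (Or.inr hAC)⟩, fun h => hA' h.1⟩

theorem SameSkeleton.trans {T T' T'' : RootedRankDecomposition V N} {Y : Set ι}
    (h : SameSkeleton T T' Y) (h' : SameSkeleton T' T'' Y) : SameSkeleton T T'' Y :=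
  ⟨fun w => (h'.1 w).trans (h.1 w), fun u w hu hw =>
    (h'.2 u w ((h.1 u).2 hu) ((h.1 w).2 hw)).trans (h.2 u w hu hw)⟩

/-- Each exchange strictly enlarges the set of pure factors, which lives in a finite type. -/
theorem exists_dealternated [Finite ι] [Fintype N] (T : RootedRankDecomposition V N)
    (X : Set ι) :
    ∃ T' : RootedRankDecomposition V N, T'.width ≤ T.width ∧
      (∀ Y, Y ⊆ X ∨ X ⊆ Y ∨ Y ⊆ Xᶜ → SameSkeleton T T' Y) ∧
      T.pureFactors X ⊆ T'.pureFactors X ∧ T'.Dealternated X := by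
  induction hS : T.pureFactors X using (wellFounded_gt (α := Set (Set ι))).induction
    generalizing T with
  | _ S ih =>
    by_cases h : T.Dealternated X
    · exact ⟨T, le_rfl, fun Y _ => ⟨fun _ => Iff.rfl, fun _ _ _ _ => Iff.rfl⟩, hS.symm.subset, h⟩
    · obtain ⟨T₁, hw, hs, hf⟩ := exists_swap_of_not_dealternated h
      obtain ⟨T₂, hw', hs', hf', hd⟩ := ih _ (hS ▸ hf) T₁ rfl
      exact ⟨T₂, hw'.trans hw, fun Y hY => (hs Y hY).trans (hs' Y hY), hS ▸ hf.1.trans hf', hd⟩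

end Dealternation

/-! ### Bounding the number of run tops. -/

section Counting

variable {T : RootedRankDecomposition V N} {r r' : N} {X : Set ι}

/-- The next run top has the same trace rank and no larger connectivity. -/
def Descends (T : RootedRankDecomposition V N) (X : Set ι) (r : N) : Prop :=
  ∃ r', T.NextTop X r r' ∧ traceRank V X (T.leaves r) = traceRank V X (T.leaves r') ∧
    conn V (T.leaves r') ≤ conn V (T.leaves r)

/-- Otherwise `r'` would be a peak, and the blocks around it could be exchanged. -/
theorem Dealternated.descends (hT : T.Dealternated X) (h : T.NextTop X r r')
    (htr : traceRank V X (T.leaves r) = traceRank V X (T.leaves r')) (hd : T.Descends X r') :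
    conn V (T.leaves r') < conn V (T.leaves r) ∧ T.Descends X r := by
  obtain ⟨r₂, h2, htr2, hc⟩ := hd
  have hlt : conn V (T.leaves r') < conn V (T.leaves r) :=
    (hT r r' r₂ h h2 (htr.trans htr2)).resolve_right hc.not_gt
  exact ⟨hlt, r', h, htr, hlt.le⟩

theorem traceRank_squeeze {r₁ : N} (h : T.tree.Le r r₁) (h' : T.tree.Le r₁ r')
    (htr : traceRank V X (T.leaves r) = traceRank V X (T.leaves r')) :
    traceRank V X (T.leaves r) = traceRank V X (T.leaves r₁) ∧
      traceRank V X (T.leaves r₁) = traceRank V X (T.leaves r') := by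
  have h1 := traceRank_mono (V := V) (X := X) (leaves_mono h)
  have h2 := traceRank_mono (V := V) (X := X) (leaves_mono h')
  omega

/-- Descent propagates downwards: below a descending run top all steps are strictly falling. -/
theorem Dealternated.conn_lt_of_descends (hT : T.Dealternated X)
    (h : Relation.TransGen (T.NextTop X) r r')
    (htr : traceRank V X (T.leaves r) = traceRank V X (T.leaves r')) (hd : T.Descends X r') :
    conn V (T.leaves r') < conn V (T.leaves r) ∧ T.Descends X r := by
  induction h using Relation.TransGen.head_induction_on with
  | single h => exact hT.descends h htr hd
  | head h h' ih =>
    obtain ⟨e1, e2⟩ := traceRank_squeeze h.lt.1 (lt_of_transGen_nextTop h').1 htr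
    obtain ⟨h1, h2⟩ := ih e2
    obtain ⟨h3, h4⟩ := hT.descends h e1 h2
    exact ⟨h1.trans h3, h4⟩

/-- Conversely, above a run top that does not descend, all steps are strictly rising. -/
theorem Dealternated.conn_lt_of_not_descends (hT : T.Dealternated X)
    (h : Relation.TransGen (T.NextTop X) r r')
    (htr : traceRank V X (T.leaves r) = traceRank V X (T.leaves r')) (hd : ¬ T.Descends X r) :
    conn V (T.leaves r) < conn V (T.leaves r') := by
  have step : ∀ {a b}, T.NextTop X a b → traceRank V X (T.leaves a) = traceRank V X (T.leaves b) →
      ¬ T.Descends X a → conn V (T.leaves a) < conn V (T.leaves b) := fun h htr hd =>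
    lt_of_not_ge fun hle => hd ⟨_, h, htr, hle⟩
  induction h using Relation.TransGen.head_induction_on with
  | single h => exact step h htr hd
  | head h h' ih =>
    obtain ⟨e1, e2⟩ := traceRank_squeeze h.lt.1 (lt_of_transGen_nextTop h').1 htr
    exact (step h e1 hd).trans (ih e2 fun hd' => hd (hT.descends h e1 hd').2)

/-- A run top is determined by the highest vertex below it, its trace rank, its connectivity and
whether it descends. Run tops sharing the vertex are comparable with no vertex in between; with
equal trace rank and flag, their connectivities differ. -/
theorem Dealternated.card_runTop_le [Fintype N] (hT : T.Dealternated X) {k : ℕ}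
    (hk : T.width ≤ k) (hX : conn V X ≤ k) :
    {r | T.RunTop X r}.ncard ≤
      {s | T.Vertex X s}.ncard * ((2 * k + 1) * ((k + 1) * 2)) := by
  classical
  have hs : ∀ r, ∃ s, T.RunTop X r → T.Vertex X s ∧ T.tree.Le s r ∧
      ∀ u, T.Vertex X u → T.tree.Le u r → T.tree.Le u s := by
    intro r
    by_cases hr : T.RunTop X r
    · obtain ⟨s, hs⟩ := hr.mixed.exists_highest_vertex
      exact ⟨s, fun _ => hs⟩
    · exact ⟨r, fun h => absurd h hr⟩
  choose s hs using hs
  let f : N → N × ℕ × ℕ × Bool := fun r =>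
    (s r, traceRank V X (T.leaves r), conn V (T.leaves r), decide (T.Descends X r))
  let target : Finset (N × ℕ × ℕ × Bool) := (Finset.univ.filter fun w => T.Vertex X w) ×ˢ
    Finset.range (2 * k + 1) ×ˢ Finset.range (k + 1) ×ˢ Finset.univ
  have key : ∀ r r', T.RunTop X r → T.RunTop X r' → f r = f r' → ¬ T.tree.Lt r r' := by
    intro r r' hr hr' hf hlt
    simp only [f, Prod.mk.injEq, decide_eq_decide] at hf
    obtain ⟨h1, h2, h3, h4⟩ := hf
    have hchain : Relation.TransGen (T.NextTop X) r r' :=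
      transGen_nextTop (Or.inl rfl) (Or.inl rfl) hr hr' hlt fun w hw hwr' hv => by
        have := (hs r' hr').2.2 w hv hwr'
        rw [← h1] at this
        exact hw.not_le (this.trans (hs r hr).2.1)
    by_cases hd : T.Descends X r'
    · exact (hT.conn_lt_of_descends hchain h2 hd).1.ne h3.symm
    · exact (hT.conn_lt_of_not_descends hchain h2 fun h => hd (h4.1 h)).ne h3
  have hcard : (Finset.univ.filter fun r => T.RunTop X r).card ≤ target.card := by
    refine Finset.card_le_card_of_injOn f ?_ ?_
    · intro r hr
      have hr : T.RunTop X r := by simpa using hr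
      have h1 := traceRank_le (V := V) (X := X) (S := T.leaves r)
      have h2 := T.conn_leaves_le_width r
      have h3 := (hs r hr).1
      simp only [target, f, Finset.coe_product, Set.mem_prod, Finset.mem_coe, Finset.mem_filter,
        Finset.mem_univ, true_and, Finset.mem_range, and_true]
      exact ⟨h3, by omega, by omega⟩
    · intro r hr r' hr' hf
      have hr : T.RunTop X r := by simpa using hr
      have hr' : T.RunTop X r' := by simpa using hr'
      have hsr := (hs r hr).2.1
      have hsr' := (hs r' hr').2.1
      have h1 : s r = s r' := congrArg Prod.fst hf
      rw [← h1] at hsr'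
      by_contra hne
      rcases hsr.total hsr' with h | h
      · exact key r r' hr hr' hf ⟨h, hne⟩
      · exact key r' r hr' hr hf.symm ⟨h, Ne.symm hne⟩
  have e1 : {r | T.RunTop X r}.ncard = (Finset.univ.filter fun r => T.RunTop X r).card := by
    rw [← Set.ncard_coe_finset]
    congr
    ext
    simp
  have e2 : {s | T.Vertex X s}.ncard = (Finset.univ.filter fun w => T.Vertex X w).card := by
    rw [← Set.ncard_coe_finset]
    congr
    ext
    simp
  rw [e1, e2]
  simpa [target, Finset.card_product] using hcard

end Counting

end RootedRankDecomposition

namespace RootedRankDecomposition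

open RootedTreeOn

variable {F : Type*} [Field F] {d : ℕ} {ι : Type*} {V : ι → Submodule F (Fin d → F)}
  {N M : Type*}

/-! ### Covering by factors -/

section Cover

variable {T : RootedRankDecomposition V N} {X : Set ι} {r r' c w : N} {i : ι}

/-- One child of `w` has all its leaves in `X`, the other one none. -/
def SplitsAt (T : RootedRankDecomposition V N) (X : Set ι) (w b : N) : Prop :=
  b ∈ T.tree.children w ∧ T.leaves b ⊆ X ∧
    ∃ a ∈ T.tree.children w, a ≠ b ∧ T.leaves a ⊆ Xᶜ

theorem SplitsAt.vertex {b : N} (h : T.SplitsAt X w b) : T.Vertex X w := by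
  obtain ⟨hb, hbX, a, ha, hab, haX⟩ := h
  exact ⟨a, ha, b, hb, hab, Or.inl ⟨haX, hbX⟩⟩

theorem SplitsAt.not_mixed {b : N} (h : T.SplitsAt X w b) (hcw : T.tree.Lt c w) :
    ¬ T.Mixed X c := by
  obtain ⟨hb, hbX, a, ha, hab, haX⟩ := h
  obtain ⟨e, he, hce⟩ := exists_child_of_lt hcw
  intro hc
  by_cases heb : e = b
  · exact hc.1 ((leaves_mono (heb ▸ hce)).trans hbX)
  by_cases hea : e = a
  · exact hc.2 ((leaves_mono (hea ▸ hce)).trans haX)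
  rcases T.isLeaf_or_children w with hl | ⟨x, y, -, hxy⟩
  · exact (Set.eq_empty_iff_forall_notMem.1 hl e) he
  · rw [hxy] at he ha hb
    simp only [Set.mem_insert_iff, Set.mem_singleton_iff] at he ha hb
    rcases he with rfl | rfl <;> rcases ha with rfl | rfl <;> rcases hb with rfl | rfl <;>
      contradiction

/-- The member `i` of `X` belongs to the block of members of `X` with top node `r`. -/
def Owner (T : RootedRankDecomposition V N) (X : Set ι) (r : N) (i : ι) : Prop :=
  (T.RunTop X r ∧ ∃ c, T.tree.Lt c r ∧ T.Mixed X c ∧ T.leaves r \ T.leaves c ⊆ X ∧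
    i ∈ T.leaves r \ T.leaves c) ∨ ∃ b, T.SplitsAt X r b ∧ i ∈ T.leaves b

theorem Owner.mem (h : T.Owner X r i) : i ∈ X := by
  rcases h with ⟨-, c, -, -, h, hi⟩ | ⟨b, hb, hi⟩
  · exact h hi
  · exact hb.2.1 hi

theorem Owner.mem_leaves (h : T.Owner X r i) : i ∈ T.leaves r := by
  rcases h with ⟨-, c, -, -, h, hi⟩ | ⟨b, hb, hi⟩
  · exact hi.1
  · exact leaves_mono (lt_of_mem_children hb.1).1 hi

theorem Owner.mixed [Finite N] (h : T.Owner X r i) : T.Mixed X r := by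
  rcases h with ⟨h, -⟩ | ⟨b, hb, -⟩
  · exact h.mixed
  · exact hb.vertex.mixed

/-- If `i` belonged to blocks at both nodes, the upper block would extend the lower one beyond its
maximal top; and below a leaf point nothing is mixed. -/
theorem Owner.not_lt [Finite N] (h : T.Owner X r i) (h' : T.Owner X r' i) :
    ¬ T.tree.Lt r r' := by
  intro hlt
  rcases h' with ⟨-, c', hc'r', hc', hsub, hi'⟩ | ⟨b', hb', -⟩
  · have hc'r : T.tree.Le c' r := by
      rcases le_total_of_sdiff_subset h.mixed hlt.1 hsub with h1 | h1
      · exact absurd (leaves_mono h1 h.mem_leaves) hi'.2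
      · exact h1
    have hlt' : T.tree.Lt c' r := ⟨hc'r, fun e => hi'.2 (e ▸ h.mem_leaves)⟩
    rcases h with ⟨hr, -⟩ | ⟨b, hb, -⟩
    · exact hr.2 r' hlt ((Set.sdiff_subset_sdiff_right (leaves_mono hc'r)).trans hsub)
    · exact hb.not_mixed hlt' hc'
  · exact hb'.not_mixed hlt h.mixed

theorem Owner.unique [Finite N] (h : T.Owner X r i) (h' : T.Owner X r' i) : r = r' := by
  by_contra hne
  rcases le_total_of_mem h.mem_leaves h'.mem_leaves with h1 | h1
  · exact h.not_lt h' ⟨h1, hne⟩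
  · exact h'.not_lt h ⟨h1, Ne.symm hne⟩

theorem exists_lowest_mixed [Finite N] (hw : T.Mixed X w) (hi : i ∈ T.leaves w) :
    ∃ w', T.Mixed X w' ∧ i ∈ T.leaves w' ∧
      ∀ c ∈ T.tree.children w', i ∈ T.leaves c → ¬ T.Mixed X c := by
  induction w using T.tree.toRootedTreeOn.downward_induction with
  | step w ih =>
    by_cases h : ∃ c ∈ T.tree.children w, i ∈ T.leaves c ∧ T.Mixed X c
    · obtain ⟨c, hc, hic, hcm⟩ := h
      exact ih c (lt_of_mem_children hc) hcm hic
    · push Not at h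
      exact ⟨w, hw, hi, h⟩

/-- At the lowest mixed node above `i` the child containing `i` is full. A mixed sibling makes it
part of a block, an empty one makes the node a leaf point. -/
theorem exists_owner [Finite N] (hroot : T.Mixed X T.tree.root) (hi : i ∈ X) :
    ∃ r, T.Owner X r i := by
  obtain ⟨w, hw, hiw, hlow⟩ := exists_lowest_mixed (i := i) hroot (T.leaves_root ▸ Set.mem_univ i)
  obtain ⟨a₀, ha₀⟩ := hw.exists_children
  obtain ⟨a, ha, hia⟩ := mem_leaves_child ha₀ hiw
  have haX : T.leaves a ⊆ X :=
    (not_mixed_iff.1 (hlow a ha hia)).resolve_right fun h => h hia hi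
  obtain ⟨b, hb, hab, hunion⟩ := exists_sibling ha
  have hib : i ∉ T.leaves b := Set.disjoint_left.1 (disjoint_leaves_children ha hb hab) hia
  by_cases hbm : T.Mixed X b
  · have hbw := lt_of_mem_children hb
    have hsub : T.leaves w \ T.leaves b ⊆ X := fun j hj =>
      haX ((hunion ▸ hj.1 : j ∈ T.leaves a ∪ T.leaves b).resolve_right hj.2)
    obtain ⟨r, hwr, hrb, htop⟩ := exists_highest_extension hsub
    have hbr := hbw.trans_le hwr
    exact ⟨r, Or.inl ⟨⟨⟨b, hbr, hbm, hrb⟩, htop⟩, b, hbr, hbm, hrb, leaves_mono hwr hiw, hib⟩⟩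
  · rcases not_mixed_iff.1 hbm with h | h
    · exact absurd (hunion ▸ Set.union_subset haX h) hw.1
    · exact ⟨w, Or.inr ⟨a, ⟨ha, haX, b, hb, hab.symm, h⟩, hia⟩⟩

theorem exists_lowest_base [Finite N] (hcr : T.tree.Lt c r) (hc : T.Mixed X c)
    (h : T.leaves r \ T.leaves c ⊆ X) :
    ∃ c₀, T.tree.Lt c₀ r ∧ T.Mixed X c₀ ∧ T.leaves r \ T.leaves c₀ ⊆ X ∧
      ∀ c', T.Mixed X c' → T.leaves r \ T.leaves c' ⊆ X → ¬ T.tree.Lt c' c₀ := by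
  induction c using T.tree.toRootedTreeOn.downward_induction with
  | step c ih =>
    by_cases h1 : ∃ c', T.Mixed X c' ∧ T.leaves r \ T.leaves c' ⊆ X ∧ T.tree.Lt c' c
    · obtain ⟨c', h2, h3, h4⟩ := h1
      exact ih c' h4 (h4.trans hcr) h2 h3
    · push Not at h1
      exact ⟨c, hcr, hc, h, h1⟩

/-- The lowest admissible base gives the whole block at once. A run top is never a leaf point, so
the two kinds of ownership do not mix. -/
theorem isFactor_owner [Finite N] (T : RootedRankDecomposition V N) (X : Set ι) (r : N) :
    T.IsFactor {i | T.Owner X r i} := by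
  by_cases hr : T.RunTop X r
  · obtain ⟨c, hcr, hc, hsub⟩ := hr.1
    obtain ⟨c₀, hc₀r, hc₀, hsub₀, hmin⟩ := exists_lowest_base hcr hc hsub
    refine isFactor_iff.2 (Or.inr ⟨r, c₀, Set.Subset.antisymm ?_ ?_⟩)
    · rintro i (⟨-, c', hc'r, hc', hsub', hi⟩ | ⟨b, hb, -⟩)
      · refine ⟨hi.1, fun hi₀ => hi.2 ?_⟩
        have hle : T.tree.Le c₀ c' := by
          rcases le_total_of_sdiff_subset hc' hc'r.1 hsub₀ with h | h
          · by_cases e : c' = c₀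
            · exact e ▸ T.tree.le_refl _
            · exact absurd (h.lt_of_ne e) (hmin c' hc' hsub')
          · exact h
        exact leaves_mono hle hi₀
      · exact absurd hc (hb.not_mixed hcr)
    · exact fun i hi => Or.inl ⟨hr, c₀, hc₀r, hc₀, hsub₀, hi⟩
  · by_cases hb : ∃ b, T.SplitsAt X r b
    · obtain ⟨b, hb⟩ := hb
      refine isFactor_iff.2 (Or.inl ⟨b, Set.Subset.antisymm ?_ ?_⟩)
      · rintro i (⟨h, -⟩ | ⟨b', hb', hi⟩)
        · exact absurd h hr
        · have : b' = b := by
            obtain ⟨hbc, hbX, a, ha, hab, haX⟩ := hb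
            by_contra hne
            by_cases hb'a : b' = a
            · subst hb'a
              obtain ⟨j, hj⟩ := T.leaves_nonempty b'
              exact haX hj (hb'.2.1 hj)
            · obtain ⟨e, he, hbe, hu⟩ := exists_sibling hbc
              obtain ⟨j, hj⟩ := T.leaves_nonempty b'
              obtain ⟨k, hk⟩ := T.leaves_nonempty a
              have hj' := leaves_mono (lt_of_mem_children hb'.1).1 hj
              have hk' := leaves_mono (lt_of_mem_children ha).1 hk
              rw [hu] at hj' hk'
              have e1 : b' = e := by
                rcases hj' with h | h
                · exact absurd (children_eq_of_common hb'.1 hbc hj h) hne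
                · exact children_eq_of_common hb'.1 he hj h
              have e2 : a = e := by
                rcases hk' with h | h
                · exact absurd (children_eq_of_common ha hbc hk h) hab
                · exact children_eq_of_common ha he hk h
              exact hb'a (e1.trans e2.symm)
          exact this ▸ hi
      · exact fun i hi => Or.inr ⟨b, hb, hi⟩
    -- A node of neither kind, such as a branch point that is no run top, owns the empty factor.
    · refine isFactor_iff.2 (Or.inr ⟨r, r, ?_⟩)
      rw [Set.sdiff_self]
      refine Set.eq_empty_iff_forall_notMem.2 ?_
      rintro i (⟨h, -⟩ | ⟨b, h, -⟩)
      · exact hr h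
      · exact hb ⟨b, h⟩

theorem exists_factor_partition [Finite N] (T : RootedRankDecomposition V N) {X : Set ι}
    (hX : X.Nonempty) :
    ∃ 𝓕 : Finset (Set ι),
      𝓕.card ≤ {r | T.RunTop X r}.ncard + {s | T.Vertex X s}.ncard + 1 ∧
      (∀ A ∈ 𝓕, T.IsFactor A ∧ A ⊆ X) ∧ (𝓕 : Set (Set ι)).PairwiseDisjoint id ∧
      ⋃₀ (𝓕 : Set (Set ι)) = X := by
  classical
  have _ := Fintype.ofFinite N
  by_cases hroot : T.Mixed X T.tree.root
  · let R : Finset N := Finset.univ.filter fun r => T.RunTop X r ∨ T.Vertex X r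
    refine ⟨R.image fun r => {i | T.Owner X r i}, ?_, ?_, ?_, ?_⟩
    · have h1 : R.card = ({r | T.RunTop X r} ∪ {s | T.Vertex X s}).ncard := by
        rw [← Set.ncard_coe_finset]
        congr
        ext
        simp [R]
      have h2 := Set.ncard_union_le {r | T.RunTop X r} {s | T.Vertex X s}
      have h3 : (R.image fun r => {i | T.Owner X r i}).card ≤ R.card := Finset.card_image_le
      omega
    · intro A hA
      obtain ⟨r, -, rfl⟩ := Finset.mem_image.1 hA
      exact ⟨T.isFactor_owner X r, fun i hi => Owner.mem hi⟩
    · intro A hA B hB hAB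
      obtain ⟨r, -, rfl⟩ := Finset.mem_image.1 (Finset.mem_coe.1 hA)
      obtain ⟨r', -, rfl⟩ := Finset.mem_image.1 (Finset.mem_coe.1 hB)
      refine Set.disjoint_left.2 fun i hi hi' => hAB ?_
      rw [Owner.unique (T := T) (X := X) hi hi']
    · refine Set.Subset.antisymm ?_ fun i hi => ?_
      · refine Set.sUnion_subset fun A hA => ?_
        obtain ⟨r, -, rfl⟩ := Finset.mem_image.1 (Finset.mem_coe.1 hA)
        exact fun i hi => Owner.mem hi
      · obtain ⟨r, hr⟩ := exists_owner hroot hi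
        refine ⟨_, Finset.mem_coe.2 (Finset.mem_image.2 ⟨r, ?_, rfl⟩), hr⟩
        simp only [R, Finset.mem_filter, Finset.mem_univ, true_and]
        rcases hr with ⟨h, -⟩ | ⟨b, hb, -⟩
        · exact Or.inl h
        · exact Or.inr hb.vertex
  -- If the root is not mixed, `X` is everything and a single factor; this is the `+ 1` in the
  -- bound.
  · have hroot' : X = T.leaves T.tree.root := by
      obtain ⟨i, hi⟩ := hX
      rw [leaves_root]
      refine Set.univ_subset_iff.1 ?_
      rw [← T.leaves_root]
      refine (not_mixed_iff.1 hroot).resolve_right fun h => ?_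
      exact h (T.leaves_root ▸ Set.mem_univ i) hi
    refine ⟨{X}, by simp, ?_, by simp, by simp⟩
    intro A hA
    rw [Finset.mem_singleton.1 hA]
    exact ⟨isFactor_iff.2 (Or.inl ⟨_, hroot'⟩), subset_rfl⟩

end Cover

/-! ### Changing the node set, and laminarity of leaf sets. -/

section Relabel

/-- The same decomposition on a relabelled set of nodes. -/
def relabel (T : RootedRankDecomposition V M) (e : M ≃ N) : RootedRankDecomposition V N :=
  have hiter : ∀ k v, (fun v => e (T.tree.parent (e.symm v)))^[k] (e v) =
      e (T.tree.parent^[k] v) := by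
    intro k
    induction k with
    | zero => exact fun _ => rfl
    | succ k ih =>
      intro v
      rw [Function.iterate_succ_apply, Function.iterate_succ_apply, e.symm_apply_apply, ih]
  let tree : RootedTreeOn N :=
    { root := e T.tree.root
      parent := fun v => e (T.tree.parent (e.symm v))
      parent_root := by rw [e.symm_apply_apply, T.tree.parent_root]
      reaches_root := fun v => by
        obtain ⟨k, hk⟩ := T.tree.reaches_root (e.symm v)
        refine ⟨k, ?_⟩
        have := hiter k (e.symm v)
        rwa [e.apply_symm_apply, hk] at this }
  have hch : ∀ v, tree.children v = e '' T.tree.children (e.symm v) := by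
    intro v
    ext c
    rw [Equiv.image_eq_preimage_symm]
    change (c ≠ e T.tree.root ∧ e (T.tree.parent (e.symm c)) = v) ↔
      (e.symm c ≠ T.tree.root ∧ T.tree.parent (e.symm c) = e.symm v)
    rw [Equiv.eq_symm_apply, ne_eq, ne_eq, Equiv.symm_apply_eq]
  have hleaf : ∀ v, tree.IsLeaf v ↔ T.tree.IsLeaf (e.symm v) := by
    intro v
    unfold RootedTreeOn.IsLeaf
    rw [hch, Set.image_eq_empty]
  { tree :=
      { tree with
        leaf_or_two_children := fun v => by
          rw [hleaf, hch, Set.ncard_image_of_injective _ e.injective]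
          exact T.tree.leaf_or_two_children _
        two_leaves := by
          obtain ⟨a, ha, b, hb, hab⟩ := T.tree.two_leaves
          exact ⟨e a, (hleaf _).2 (by rwa [e.symm_apply_apply]), e b,
            (hleaf _).2 (by rwa [e.symm_apply_apply]), e.injective.ne hab⟩ }
    leaf := T.leaf.trans (e.subtypeEquiv fun v => by
      change _ ↔ tree.IsLeaf (e v)
      rw [hleaf, e.symm_apply_apply]) }

theorem relabel_iterate_parent (T : RootedRankDecomposition V M) (e : M ≃ N) (k : ℕ) (v : M) :
    (T.relabel e).tree.parent^[k] (e v) = e (T.tree.parent^[k] v) := by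
  induction k generalizing v with
  | zero => rfl
  | succ k ih =>
    rw [Function.iterate_succ_apply, Function.iterate_succ_apply, ← ih]
    congr 1
    change e (T.tree.parent (e.symm (e v))) = _
    rw [e.symm_apply_apply]

theorem leaves_relabel (T : RootedRankDecomposition V M) (e : M ≃ N) (v : M) :
    (T.relabel e).leaves (e v) = T.leaves v := by
  ext i
  change (∃ k, (T.relabel e).tree.parent^[k] (e (T.leaf i)) = e v) ↔
    ∃ k, T.tree.parent^[k] (T.leaf i) = v
  simp only [relabel_iterate_parent, EmbeddingLike.apply_eq_iff_eq]

/-- Optimality is tested on node sets `Fin m` only; relabelling extends it to every finite node set.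
-/
theorem IsOptimum.width_le [Fintype N] [Fintype M] {T : RootedRankDecomposition V N}
    (hT : T.IsOptimum) (S : RootedRankDecomposition V M) : T.width ≤ S.width := by
  refine (hT _ (S.relabel (Fintype.equivFin M))).trans (width_le_iff.2 fun w => ?_)
  obtain ⟨v, rfl⟩ := (Fintype.equivFin M).surjective w
  rw [leaves_relabel]
  exact S.conn_leaves_le_width v

end Relabel

theorem leaves_laminar (Tb : RootedRankDecomposition V M) (x y : M) :
    Tb.leaves y ⊆ Tb.leaves x ∨ Tb.leaves x ⊆ Tb.leaves y ∨ Tb.leaves y ⊆ (Tb.leaves x)ᶜ := by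
  by_cases h : Disjoint (Tb.leaves y) (Tb.leaves x)
  · exact Or.inr (Or.inr (Set.subset_compl_iff_disjoint_right.2 h))
  · obtain ⟨i, h1, h2⟩ := Set.not_disjoint_iff.1 h
    rcases le_total_of_mem h1 h2 with h | h
    · exact Or.inl (leaves_mono h)
    · exact Or.inr (Or.inl (leaves_mono h))

theorem leaves_subset_or_of_not_lt {Tb : RootedRankDecomposition V M} {x y : M}
    (hxy : ¬ Tb.tree.Lt x y) :
    Tb.leaves y ⊆ Tb.leaves x ∨ Tb.leaves y ⊆ (Tb.leaves x)ᶜ := by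
  by_cases h : Disjoint (Tb.leaves y) (Tb.leaves x)
  · exact Or.inr (Set.subset_compl_iff_disjoint_right.2 h)
  · obtain ⟨i, h1, h2⟩ := Set.not_disjoint_iff.1 h
    rcases le_total_of_mem h1 h2 with h | h
    · exact Or.inl (leaves_mono h)
    · by_cases e : x = y
      · exact Or.inl (e ▸ subset_rfl)
      · exact absurd ⟨h, e⟩ hxy

end RootedRankDecomposition

theorem lemma8p10 (F : Type*) [Field F] [Finite F] (g : ℕ → ℕ) :
    ∃ f : ℕ → ℕ,
      ∀ (d : ℕ) (ι : Type*) [Finite ι] (V : ι → Submodule F (Fin d → F))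
        (M : Type*) [Fintype M] (N : Type*) [Fintype N]
        (ℓ : ℕ) (Tb : RootedRankDecomposition V M) (T : RootedRankDecomposition V N) (x : M),
        Tb.width = ℓ →
        T.IsOptimum →
        (Tb.mixedSkeleton x T).verts.ncard ≤ g ℓ →
        ∃ T' : RootedRankDecomposition V N,
          T'.IsOptimum ∧
          (∃ 𝓕 : Finset (Set ι), 𝓕.card ≤ f ℓ ∧
            (∀ A ∈ 𝓕, Tb.IsNodeFactor x T' A) ∧
            (𝓕 : Set (Set ι)).PairwiseDisjoint id ∧
            ⋃₀ (𝓕 : Set (Set ι)) = Tb.leaves x) ∧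
          (∀ y : M, Tb.mixedSkeleton y T' = Tb.mixedSkeleton y T) ∧
          (∀ y : M, ¬ Tb.tree.Lt x y →
            ∀ A : Set ι, Tb.IsNodeFactor y T A → Tb.IsNodeFactor y T' A) := by
  -- Run tops, plus skeleton vertices, plus one.
  refine ⟨fun ℓ => g ℓ * ((2 * ℓ + 1) * ((ℓ + 1) * 2)) + g ℓ + 1, ?_⟩
  intro d ι _ V M _ N _ ℓ Tb T x hℓ hopt hg
  obtain ⟨T', hw, hs, hf, hd⟩ := T.exists_dealternated (Tb.leaves x)
  have hskel : ∀ y : M, Tb.mixedSkeleton y T' = Tb.mixedSkeleton y T := fun y =>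
    have h := hs _ (Tb.leaves_laminar x y)
    RootedRankDecomposition.mixedSkeleton_eq h.1 h.2
  refine ⟨T', fun m S => hw.trans (hopt m S), ?_, hskel, ?_⟩
  · obtain ⟨𝓕, hcard, hfac, hdisj, hunion⟩ := T'.exists_factor_partition (Tb.leaves_nonempty x)
    refine ⟨𝓕, ?_, hfac, hdisj, hunion⟩
    have hv : {s | T'.Vertex (Tb.leaves x) s}.ncard ≤ g ℓ := by
      rw [← hskel x] at hg
      have e : (Tb.mixedSkeleton x T').verts = {s | T'.Vertex (Tb.leaves x) s} :=
        Set.ext fun s => RootedRankDecomposition.mem_skeletonVerts_iff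
      rwa [e] at hg
    -- `Tb` gives both bounds: the optimum width is at most `ℓ`, and so is the connectivity of the
    -- leaf set of `x`.
    have hr := hd.card_runTop_le (k := ℓ) (hw.trans (hℓ ▸ hopt.width_le Tb))
      (hℓ ▸ Tb.conn_leaves_le_width x)
    have hr' := hr.trans (Nat.mul_le_mul_right _ hv)
    simp only
    omega
  · rintro y hy A ⟨hA, hAy⟩
    have hAX := (RootedRankDecomposition.leaves_subset_or_of_not_lt hy).imp hAy.trans hAy.trans
    exact ⟨(hf ⟨hA, hAX⟩).1, hAy⟩
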